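/- Let $SG(0)$ be a triangle, and let $SG(n+1)$ be obtained from three copies of $SG(n)$ (lower left, lower right, top) by identifying their outmost vertices pairwise, as in the usual construction of the two-dimensional Sierpinski gasket; $SG(n)$ has $3^{n+1}$ edges and $\tfrac32(3^n+1)$ vertices. All stages are placed with the same leftmost vertex $o$, so that $SG(k)\subseteq SG(N)$ for $k\le N$ is the sub-triangle at $o$. Let $a_n$ and $b_n$ be the rightmost and the topmost vertex of $SG(n)$, and let $c_n$ be the vertex of $SG(n+1)$ such that $a_n,b_n,c_n$ are the corners of the largest lacunary triangle of $SG(n+1)$. For a vertex $x$ of $SG(N)$ let $F_j(N,x)=f_j(N,x)/f(N)$, where $f(N)$ is the number of spanning trees of $SG(N)$ and $f_j(N,x)$ is the number of those in which $x$ has degree $j$. Then for all integers $n,m\ge 0$: \begin{align*} F_1(n+m+1,a_n) &= \tfrac{1815}{5488}\left(\tfrac{3}{5}\right)^n - \tfrac{99}{1372}\left(\tfrac{1}{25}\right)^n + \tfrac{55}{16464}\left(\tfrac{1}{375}\right)^n + \left(\tfrac{1}{15}\right)^m\Bigl\{ - \tfrac{121}{5488}\left(\tfrac{3}{5}\right)^n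 - \tfrac{22}{1029}\left(\tfrac{1}{25}\right)^n + \tfrac{185}{49392}\left(\tfrac{1}{375}\right)^n \Bigr\} ,\\ F_2(n+m+1,a_n) &= \tfrac{121}{196} - \tfrac{825}{5488}\left(\tfrac{3}{5}\right)^n + \tfrac{171}{1372}\left(\tfrac{1}{25}\right)^n - \tfrac{55}{5488}\left(\tfrac{1}{375}\right)^n - \tfrac{121}{1176}\left(\tfrac{1}{15}\right)^n + \tfrac{1}{294}\left(\tfrac{1}{225}\right)^n + \left(\tfrac{1}{15}\right)^m\Bigl\{ \tfrac{55}{5488}\left(\tfrac{3}{5}\right)^n + \tfrac{38}{1029}\left(\tfrac{1}{25}\right)^n - \tfrac{185}{16464}\left(\tfrac{1}{375}\right)^n - \tfrac{143}{3528}\left(\tfrac{1}{15}\right)^n + \tfrac{11}{2646}\left(\tfrac{1}{225}\right)^n \Bigr\} ,\\ F_3(n+m+1,a_n) &= \tfrac{33}{98} - \tfrac{855}{5488}\left(\tfrac{3}{5}\right)^n - \tfrac{45}{1372}\left(\tfrac{1}{25}\right)^n + \tfrac{55}{5488}\left(\tfrac{1}{375}\right)^n + \tfrac{11}{147}\left(\tfrac{1}{15}\right)^n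 - \tfrac{1}{147}\left(\tfrac{1}{225}\right)^n + \left(\tfrac{1}{15}\right)^m\Bigl\{ \tfrac{57}{5488}\left(\tfrac{3}{5}\right)^n - \tfrac{10}{1029}\left(\tfrac{1}{25}\right)^n + \tfrac{185}{16464}\left(\tfrac{1}{375}\right)^n + \tfrac{13}{441}\left(\tfrac{1}{15}\right)^n - \tfrac{11}{1323}\left(\tfrac{1}{225}\right)^n \Bigr\} ,\\ F_4(n+m+1,a_n) &= \tfrac{9}{196} - \tfrac{135}{5488}\left(\tfrac{3}{5}\right)^n - \tfrac{27}{1372}\left(\tfrac{1}{25}\right)^n - \tfrac{55}{16464}\left(\tfrac{1}{375}\right)^n + \tfrac{11}{392}\left(\tfrac{1}{15}\right)^n + \tfrac{1}{294}\left(\tfrac{1}{225}\right)^n + \left(\tfrac{1}{15}\right)^m\Bigl\{ \tfrac{9}{5488}\left(\tfrac{3}{5}\right)^n - \tfrac{2}{343}\left(\tfrac{1}{25}\right)^n - \tfrac{185}{49392}\left(\tfrac{1}{375}\right)^n + \tfrac{13}{1176}\left(\tfrac{1}{15}\right)^n + \tfrac{11}{2646}\left(\tfrac{1}{225}\right)^n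 \Bigr\} ,\\ F_1(n+m+1,c_n) &= \tfrac{1089}{2744}\left(\tfrac{3}{5}\right)^n - \tfrac{22}{343}\left(\tfrac{1}{25}\right)^n + \tfrac{5}{8232}\left(\tfrac{1}{375}\right)^n + \left(\tfrac{1}{15}\right)^m\Bigl\{ - \tfrac{121}{1372}\left(\tfrac{3}{5}\right)^n - \tfrac{121}{4116}\left(\tfrac{1}{25}\right)^n + \tfrac{20}{3087}\left(\tfrac{1}{375}\right)^n \Bigr\} ,\\ F_2(n+m+1,c_n) &= \tfrac{121}{196} - \tfrac{495}{2744}\left(\tfrac{3}{5}\right)^n + \tfrac{38}{343}\left(\tfrac{1}{25}\right)^n - \tfrac{5}{2744}\left(\tfrac{1}{375}\right)^n - \tfrac{55}{588}\left(\tfrac{1}{15}\right)^n + \left(\tfrac{1}{15}\right)^m\Bigl\{ \tfrac{55}{1372}\left(\tfrac{3}{5}\right)^n + \tfrac{209}{4116}\left(\tfrac{1}{25}\right)^n - \tfrac{20}{1029}\left(\tfrac{1}{375}\right)^n - \tfrac{22}{441}\left(\tfrac{1}{15}\right)^n + \tfrac{10}{1323}\left(\tfrac{1}{225}\right)^n \Bigr\}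 ,\\ F_3(n+m+1,c_n) &= \tfrac{33}{98} - \tfrac{513}{2744}\left(\tfrac{3}{5}\right)^n - \tfrac{10}{343}\left(\tfrac{1}{25}\right)^n + \tfrac{5}{2744}\left(\tfrac{1}{375}\right)^n + \tfrac{10}{147}\left(\tfrac{1}{15}\right)^n + \left(\tfrac{1}{15}\right)^m\Bigl\{ \tfrac{57}{1372}\left(\tfrac{3}{5}\right)^n - \tfrac{55}{4116}\left(\tfrac{1}{25}\right)^n + \tfrac{20}{1029}\left(\tfrac{1}{375}\right)^n + \tfrac{16}{441}\left(\tfrac{1}{15}\right)^n - \tfrac{20}{1323}\left(\tfrac{1}{225}\right)^n \Bigr\} ,\\ F_4(n+m+1,c_n) &= \tfrac{9}{196} - \tfrac{81}{2744}\left(\tfrac{3}{5}\right)^n - \tfrac{6}{343}\left(\tfrac{1}{25}\right)^n - \tfrac{5}{8232}\left(\tfrac{1}{375}\right)^n + \tfrac{5}{196}\left(\tfrac{1}{15}\right)^n + \left(\tfrac{1}{15}\right)^m\Bigl\{ \tfrac{9}{1372}\left(\tfrac{3}{5}\right)^n - \tfrac{11}{1372}\left(\tfrac{1}{25}\right)^n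 - \tfrac{20}{3087}\left(\tfrac{1}{375}\right)^n + \tfrac{2}{147}\left(\tfrac{1}{15}\right)^n + \tfrac{10}{1323}\left(\tfrac{1}{225}\right)^n \Bigr\} . \end{align*} -/

import Mathlib

namespace SierpinskiGasket

/-- The vertices of `SG(n)`, in the triangular lattice. The pair `(p, q)` stands for the point
`p + q * exp (i * π / 3)` of the plane, so `(1, 0)` is a unit step to the right and `(0, 1)` a unit
step to the upper right. Stage `0` is a triangle; stage `n + 1` consists of three copies of stage
`n`, the lower left, the lower right and the upper one. -/
def verts : ℕ → Finset (ℕ × ℕ)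
  | 0 => {(0, 0), (1, 0), (0, 1)}
  | n + 1 =>
      verts n ∪ (verts n).image (fun p => p + (2 ^ n, 0)) ∪ (verts n).image (fun p => p + (0, 2 ^ n))

/-- The edges of `SG(n)`, given by the same recursion. -/
def edges : ℕ → Finset (Sym2 (ℕ × ℕ))
  | 0 => {s((0, 0), (1, 0)), s((0, 0), (0, 1)), s((1, 0), (0, 1))}
  | n + 1 =>
      edges n ∪ (edges n).image (Sym2.map (fun p => p + (2 ^ n, 0))) ∪
        (edges n).image (Sym2.map (fun p => p + (0, 2 ^ n)))

/-- The vertex set of `SG(n)` as a type. -/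
abbrev Vertex (n : ℕ) : Type := {p : ℕ × ℕ // p ∈ verts n}

/-- The Sierpinski gasket graph `SG(n)`. -/
def SG (n : ℕ) : SimpleGraph (Vertex n) :=
  (SimpleGraph.fromEdgeSet (edges n : Set (Sym2 (ℕ × ℕ)))).comap Subtype.val

/-- The spanning trees of `SG(n)`: the spanning subgraphs that are trees. -/
def spanningTrees (n : ℕ) : Set (SimpleGraph (Vertex n)) :=
  {T | T ≤ SG n ∧ T.IsTree}

/-- `f(n)`, the number of spanning trees of `SG(n)`. -/
noncomputable def f (n : ℕ) : ℕ := (spanningTrees n).ncard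

/-- `f_j(n, x)`, the number of spanning trees of `SG(n)` in which exactly `j` edges are
attached to the vertex `x`. -/
noncomputable def fdeg (j n : ℕ) (x : Vertex n) : ℕ :=
  {T ∈ spanningTrees n | (T.neighborSet x).ncard = j}.ncard

/-- `F_j(n, x) = f_j(n, x) / f(n)`, the probability that the vertex `x` has degree `j` in a
uniformly chosen spanning tree of `SG(n)`. -/
noncomputable def F (j n : ℕ) (x : Vertex n) : ℝ := (fdeg j n x : ℝ) / (f n : ℝ)

theorem verts_subset_succ (n : ℕ) : verts n ⊆ verts (n + 1) := by
  intro p hp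
  simp [verts, hp]

theorem verts_mono {k n : ℕ} (h : k ≤ n) : verts k ⊆ verts n := by
  induction h with
  | refl => exact Finset.Subset.refl _
  | step _ ih => exact ih.trans (verts_subset_succ _)

theorem corner_mem (n : ℕ) : (2 ^ n, 0) ∈ verts n ∧ (0, 2 ^ n) ∈ verts n := by
  induction n with
  | zero => simp [verts]
  | succ n ih =>
    constructor
    · refine Finset.mem_union_left _ (Finset.mem_union_right _ ?_)
      exact Finset.mem_image.2 ⟨_, ih.1, by ext <;> simp [pow_succ, mul_two]⟩
    · refine Finset.mem_union_right _ ?_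
      exact Finset.mem_image.2 ⟨_, ih.2, by ext <;> simp [pow_succ, mul_two]⟩

theorem a_mem (n m : ℕ) : (2 ^ n, 0) ∈ verts (n + m + 1) :=
  verts_mono (by omega) (corner_mem n).1

theorem c_mem (n m : ℕ) : (2 ^ n, 2 ^ n) ∈ verts (n + m + 1) := by
  refine verts_mono (show n + 1 ≤ n + m + 1 by omega) ?_
  refine Finset.mem_union_right _ ?_
  exact Finset.mem_image.2 ⟨_, (corner_mem n).1, by ext <;> simp⟩

/-- `a_n` as a vertex of `SG(n + m + 1)`: the rightmost vertex of the copy of `SG(n)` at the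
leftmost vertex `o = (0, 0)`. -/
def a (n m : ℕ) : Vertex (n + m + 1) := ⟨(2 ^ n, 0), a_mem n m⟩

/-- `c_n` as a vertex of `SG(n + m + 1)`: together with `a_n` and the topmost vertex
`b_n = (0, 2 ^ n)` of the copy of `SG(n)` at `o`, it spans the largest lacunary triangle of the copy
of `SG(n + 1)` at `o`. -/
def c (n m : ℕ) : Vertex (n + m + 1) := ⟨(2 ^ n, 2 ^ n), c_mem n m⟩

end SierpinskiGasket

/-! Weight the edges at the marked vertex `x` by `y` and all others by 1. The weighted sum over
spanning trees is then the generating function of the degree of `x`, and its coefficients are the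
numbers `fdeg j`. To compute it recursively, trees are replaced by the spanning forests all of whose
components meet the three corners, sorted by the induced partition of the corners: five types
(`CornerPart`). Adjacent copies of `SG(n)` share one vertex and no edge, so a forest of `SG(n+1)` is
a triple of forests of `SG(n)`, and whether and to what the triple glues depends only on the three
types. This gives a trilinear recursion (`forestSum_succ`) with finitely many terms.

After division by `scale`, the coefficients no longer depend on `n` (`forestVec_succ`), and the
unweighted vector is the fixed point `plainVec` (`forestVec_one`). If only one copy sees the mark,
the recursion is linear in that copy. For a marked corner its modes are 1, 1/15, 3/5 and 1/25, and
the triangle gives the initial values (`forestVec_corner`). The points `a_n` and `c_n` are corners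
of two copies of `SG(n)`, so one gluing is bilinear in two such vectors. The `m` further gluings
only involve the number of trees and the mean of two two-component types, with modes 1 and 1/15
(`forestVec_add`). Comparing coefficients of `y` gives the formulas (`F_eq_of_forestVec`).

The constant terms come from the factor `limitPart y = (11 y + 3 y ^ 2) / 14` contributed by each of
the two copies: its square has coefficients 121/196, 33/98 and 9/196. -/

namespace SierpinskiGasket

/-! ### Position of the three copies in the lattice -/

/-- The three unit corners of the triangular lattice. -/
def unitCorner : Fin 3 → ℕ × ℕ := ![(0, 0), (1, 0), (0, 1)]

/-- The three corners of `SG(n)`: left, right, top. -/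
def corner (n : ℕ) (j : Fin 3) : ℕ × ℕ := 2 ^ n • unitCorner j

/-- The translation placing a copy of `SG(n)` at the `i`-th position in `SG(n + 1)`. -/
def shift (n : ℕ) (i : Fin 3) (p : ℕ × ℕ) : ℕ × ℕ := p + corner n i

theorem shift_injective (n : ℕ) (i : Fin 3) : Function.Injective (shift n i) :=
  add_left_injective _

theorem shift_corner_comm (n : ℕ) (i j : Fin 3) :
    shift n i (corner n j) = shift n j (corner n i) := add_comm _ _

theorem shift_corner_self (n : ℕ) (i : Fin 3) : shift n i (corner n i) = corner (n + 1) i := by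
  simp only [shift, corner, pow_succ, mul_two, add_smul]

theorem corner_zero (n : ℕ) : corner n 0 = (0, 0) := by simp [corner, unitCorner]
theorem corner_one (n : ℕ) : corner n 1 = (2 ^ n, 0) := by simp [corner, unitCorner]
theorem corner_two (n : ℕ) : corner n 2 = (0, 2 ^ n) := by simp [corner, unitCorner]

theorem shift_zero (n : ℕ) (p : ℕ × ℕ) : shift n 0 p = p := by
  rw [shift, corner_zero]; exact add_zero p

theorem shift_zero_eq_id (n : ℕ) : shift n 0 = id := funext (shift_zero n)

theorem verts_succ (n : ℕ) :
    verts (n + 1) = Finset.univ.biUnion fun i => (verts n).image (shift n i) := by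
  ext p
  have h1 : shift n 1 = fun p => p + (2 ^ n, 0) := by funext p; rw [shift, corner_one]
  have h2 : shift n 2 = fun p => p + (0, 2 ^ n) := by funext p; rw [shift, corner_two]
  simp only [verts, Finset.mem_union, Finset.mem_biUnion, Finset.mem_univ, true_and,
    Fin.exists_fin_succ, shift_zero_eq_id, Finset.image_id, Fin.succ_zero_eq_one,
    Fin.succ_one_eq_two, h1, h2, IsEmpty.exists_iff, or_false, or_assoc]

theorem edges_succ (n : ℕ) :
    edges (n + 1) = Finset.univ.biUnion fun i => (edges n).image (Sym2.map (shift n i)) := by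
  ext p
  have h0 : Sym2.map (shift n 0) = id := by rw [shift_zero_eq_id]; exact Sym2.map_id
  have h1 : shift n 1 = fun p => p + (2 ^ n, 0) := by funext p; rw [shift, corner_one]
  have h2 : shift n 2 = fun p => p + (0, 2 ^ n) := by funext p; rw [shift, corner_two]
  simp only [edges, Finset.mem_union, Finset.mem_biUnion, Finset.mem_univ, true_and,
    Fin.exists_fin_succ, h0, Finset.image_id, Fin.succ_zero_eq_one,
    Fin.succ_one_eq_two, h1, h2, IsEmpty.exists_iff, or_false, or_assoc]

theorem mem_verts_succ {n : ℕ} {p : ℕ × ℕ} :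
    p ∈ verts (n + 1) ↔ ∃ i, ∃ u ∈ verts n, shift n i u = p := by
  simp [verts_succ]

theorem mem_edges_succ {n : ℕ} {e : Sym2 (ℕ × ℕ)} :
    e ∈ edges (n + 1) ↔ ∃ i, ∃ d ∈ edges n, d.map (shift n i) = e := by
  simp [edges_succ]

theorem corner_mem_verts (n : ℕ) (j : Fin 3) : corner n j ∈ verts n := by
  induction n with
  | zero => fin_cases j <;> simp [corner, unitCorner, verts]
  | succ n ih => exact mem_verts_succ.2 ⟨j, _, ih, shift_corner_self n j⟩

/-- Together with nonnegativity of the coordinates this confines the stage to the triangle spanned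
by its corners, which is why translated copies can only touch at corners. -/
theorem add_le_of_mem_verts {n : ℕ} {p : ℕ × ℕ} (hp : p ∈ verts n) : p.1 + p.2 ≤ 2 ^ n := by
  induction n generalizing p with
  | zero =>
    simp only [verts, Finset.mem_insert, Finset.mem_singleton] at hp
    rcases hp with rfl | rfl | rfl <;> simp
  | succ n ih =>
    obtain ⟨i, u, hu, rfl⟩ := mem_verts_succ.1 hp
    have := ih hu
    rw [pow_succ]
    fin_cases i <;> simp [shift, corner_zero, corner_one, corner_two] <;> omega

/-- Two distinct copies of `SG(n)` in `SG(n + 1)` meet only at their common corner. -/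
theorem eq_corner_of_shift_eq {n : ℕ} {i j : Fin 3} (hij : i ≠ j) {u v : ℕ × ℕ}
    (hu : u ∈ verts n) (hv : v ∈ verts n) (h : shift n i u = shift n j v) :
    u = corner n j ∧ v = corner n i := by
  have h1 := add_le_of_mem_verts hu
  have h2 := add_le_of_mem_verts hv
  have h0 : 0 < 2 ^ n := by positivity
  obtain ⟨u1, u2⟩ := u
  obtain ⟨v1, v2⟩ := v
  fin_cases i <;> fin_cases j <;>
    simp [shift, corner_zero, corner_one, corner_two] at h h1 h2 hij ⊢ <;> omega

theorem corner_injective (n : ℕ) : Function.Injective (corner n) := by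
  intro i j h
  have h0 : 2 ^ n ≠ 0 := by positivity
  fin_cases i <;> fin_cases j <;> simp [corner_zero, corner_one, corner_two, h0.symm] at h ⊢

theorem not_isDiag_of_mem_edges {n : ℕ} {e : Sym2 (ℕ × ℕ)} (he : e ∈ edges n) : ¬ e.IsDiag := by
  induction n generalizing e with
  | zero =>
    simp only [edges, Finset.mem_insert, Finset.mem_singleton] at he
    rcases he with rfl | rfl | rfl <;> simp
  | succ n ih =>
    obtain ⟨i, d, hd, rfl⟩ := mem_edges_succ.1 he
    rw [Sym2.isDiag_map (shift_injective n i)]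
    exact ih hd

theorem mem_verts_of_mem_edges {n : ℕ} {e : Sym2 (ℕ × ℕ)} (he : e ∈ edges n) {p : ℕ × ℕ}
    (hp : p ∈ e) : p ∈ verts n := by
  induction n generalizing e p with
  | zero =>
    simp only [edges, Finset.mem_insert, Finset.mem_singleton] at he
    rcases he with rfl | rfl | rfl <;> simp at hp <;> rcases hp with rfl | rfl <;> simp [verts]
  | succ n ih =>
    obtain ⟨i, d, hd, rfl⟩ := mem_edges_succ.1 he
    obtain ⟨q, hq, rfl⟩ := Sym2.mem_map.1 hp
    exact mem_verts_succ.2 ⟨i, q, ih hd hq, rfl⟩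

theorem map_shift_injective (n : ℕ) (i : Fin 3) : Function.Injective (Sym2.map (shift n i)) :=
  Sym2.map.injective (shift_injective n i)

/-- Both ends of a shared edge would be the single common corner, making the edge a loop. -/
theorem map_shift_ne {n : ℕ} {i j : Fin 3} (hij : i ≠ j) {d e : Sym2 (ℕ × ℕ)}
    (hd : d ∈ edges n) (he : e ∈ edges n) : d.map (shift n i) ≠ e.map (shift n j) := by
  intro h
  have key : ∀ p ∈ d, p = corner n j := by
    intro p hp
    have : shift n i p ∈ e.map (shift n j) := h ▸ Sym2.mem_map.2 ⟨p, hp, rfl⟩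
    obtain ⟨q, hq, hqp⟩ := Sym2.mem_map.1 this
    exact (eq_corner_of_shift_eq hij (mem_verts_of_mem_edges hd hp)
      (mem_verts_of_mem_edges he hq) hqp.symm).1
  apply not_isDiag_of_mem_edges hd
  induction d with
  | _ p q =>
    rw [Sym2.mk_isDiag_iff, key p (Sym2.mem_mk_left p q), key q (Sym2.mem_mk_right p q)]

/-- Inclusion-exclusion: the three junctions are distinct, and each is counted twice. -/
theorem card_verts_succ (n : ℕ) : (verts (n + 1)).card + 3 = 3 * (verts n).card := by
  have hinter : ∀ i j : Fin 3, i ≠ j →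
      (verts n).image (shift n i) ∩ (verts n).image (shift n j) = {shift n i (corner n j)} := by
    intro i j hij
    ext p
    simp only [Finset.mem_inter, Finset.mem_image, Finset.mem_singleton]
    constructor
    · rintro ⟨⟨u, hu, rfl⟩, v, hv, h⟩
      rw [(eq_corner_of_shift_eq hij hu hv h.symm).1]
    · rintro rfl
      exact ⟨⟨_, corner_mem_verts n j, rfl⟩, _, corner_mem_verts n i, shift_corner_comm n j i⟩
  have hcard : ∀ i, ((verts n).image (shift n i)).card = (verts n).card := fun i =>
    Finset.card_image_of_injective _ (shift_injective n i)
  have hv : verts (n + 1) = ((verts n).image (shift n 0) ∪ (verts n).image (shift n 1)) ∪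
      (verts n).image (shift n 2) := by
    rw [verts_succ]
    ext p
    simp [Fin.exists_fin_succ]
  have h01 := Finset.card_union_add_card_inter
    ((verts n).image (shift n 0)) ((verts n).image (shift n 1))
  have h2 := Finset.card_union_add_card_inter
    ((verts n).image (shift n 0) ∪ (verts n).image (shift n 1)) ((verts n).image (shift n 2))
  rw [Finset.union_inter_distrib_right, hinter 0 2 (by decide), hinter 1 2 (by decide), ← hv,
    Finset.singleton_union, Finset.card_pair, hcard] at h2
  · rw [hinter 0 1 (by decide), Finset.card_singleton, hcard, hcard] at h01
    omega
  · intro h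
    have h0 : 2 ^ n ≠ 0 := by positivity
    simp [shift, corner_zero, corner_one, corner_two, h0.symm] at h

/-! ### Partitions of the corners -/

/-- The partitions of the three corners: all corners together, corner `i` separated from the
two others, or all corners separated. -/
inductive CornerPart
  | tree
  | iso (i : Fin 3)
  | discrete

namespace CornerPart

instance : DecidableEq CornerPart
  | tree, tree => isTrue rfl
  | discrete, discrete => isTrue rfl
  | iso i, iso j => decidable_of_iff (i = j) ⟨congrArg iso, iso.inj⟩
  | tree, iso _ | tree, discrete | iso _, tree | iso _, discrete | discrete, tree
  | discrete, iso _ => isFalse nofun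

instance : Fintype CornerPart where
  elems := {tree, iso 0, iso 1, iso 2, discrete}
  complete := by
    rintro (_ | i | _)
    · decide
    · fin_cases i <;> decide
    · decide

/-- Two corners lie in the same block. -/
def rel : CornerPart → Fin 3 → Fin 3 → Bool
  | tree, _, _ => true
  | iso i, j, k => (j == i) == (k == i)
  | discrete, j, k => j == k

/-- The number of blocks. -/
def blocks : CornerPart → ℕ
  | tree => 1
  | iso _ => 2
  | discrete => 3

theorem rel_injective {π ρ : CornerPart} (h : ∀ j k, π.rel j k = ρ.rel j k) : π = ρ := by
  revert π ρ
  decide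

theorem exists_rel (r : Fin 3 → Fin 3 → Prop) (hr : Equivalence r) :
    ∃ π : CornerPart, ∀ j k, r j k ↔ π.rel j k = true := by
  -- Of the eight patterns, transitivity rules out the three with exactly two related pairs.
  by_cases h01 : r 0 1 <;> by_cases h02 : r 0 2 <;> by_cases h12 : r 1 2
  · exact ⟨tree, by
      simp [Fin.forall_fin_succ, rel, hr.refl, hr.symm h01, hr.symm h02, hr.symm h12, *]⟩
  · exact absurd (hr.trans (hr.symm h01) h02) h12
  · exact absurd (hr.trans h01 h12) h02
  · refine ⟨iso 2, ?_⟩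
    have h20 : ¬ r 2 0 := fun h => h02 (hr.symm h)
    have h21 : ¬ r 2 1 := fun h => h12 (hr.symm h)
    simp [Fin.forall_fin_succ, rel, hr.refl, hr.symm h01, *]
  · exact absurd (hr.trans h02 (hr.symm h12)) h01
  · refine ⟨iso 1, ?_⟩
    have h10 : ¬ r 1 0 := fun h => h01 (hr.symm h)
    have h21 : ¬ r 2 1 := fun h => h12 (hr.symm h)
    simp [Fin.forall_fin_succ, rel, hr.refl, hr.symm h02, *]
  · refine ⟨iso 0, ?_⟩
    have h10 : ¬ r 1 0 := fun h => h01 (hr.symm h)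
    have h20 : ¬ r 2 0 := fun h => h02 (hr.symm h)
    simp [Fin.forall_fin_succ, rel, hr.refl, hr.symm h12, *]
  · refine ⟨discrete, ?_⟩
    have h10 : ¬ r 1 0 := fun h => h01 (hr.symm h)
    have h20 : ¬ r 2 0 := fun h => h02 (hr.symm h)
    have h21 : ¬ r 2 1 := fun h => h12 (hr.symm h)
    simp [Fin.forall_fin_succ, rel, hr.refl, *]

end CornerPart

/-! ### Connectivity in glued edge sets -/

/-- Connectivity by the edges in `S`. -/
def Reach (S : Finset (Sym2 (ℕ × ℕ))) : ℕ × ℕ → ℕ × ℕ → Prop :=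
  Relation.ReflTransGen fun u v => s(u, v) ∈ S

theorem Reach.symm {S : Finset (Sym2 (ℕ × ℕ))} {u v : ℕ × ℕ} (h : Reach S u v) : Reach S v u := by
  induction h with
  | refl => exact Relation.ReflTransGen.refl
  | tail _ h ih => exact ih.head (by rwa [Sym2.eq_swap])

theorem Reach.trans {S : Finset (Sym2 (ℕ × ℕ))} {u v w : ℕ × ℕ} (h : Reach S u v)
    (hvw : Reach S v w) : Reach S u w :=
  Relation.ReflTransGen.trans h hvw

/-- Every vertex is connected by `S` to a corner, and the connections by `S` between the corners
are those of `π`. -/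
structure Covers (n : ℕ) (S : Finset (Sym2 (ℕ × ℕ))) (π : CornerPart) : Prop where
  exists_corner : ∀ v ∈ verts n, ∃ j, Reach S (corner n j) v
  reach_iff : ∀ j k, Reach S (corner n j) (corner n k) ↔ π.rel j k = true

theorem Covers.unique {n : ℕ} {S : Finset (Sym2 (ℕ × ℕ))} {π ρ : CornerPart} (h : Covers n S π)
    (h' : Covers n S ρ) : π = ρ :=
  CornerPart.rel_injective fun j k =>
    Bool.eq_iff_iff.2 ((h.reach_iff j k).symm.trans (h'.reach_iff j k))

theorem exists_covers {n : ℕ} {S : Finset (Sym2 (ℕ × ℕ))}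
    (h : ∀ v ∈ verts n, ∃ j, Reach S (corner n j) v) : ∃ π, Covers n S π := by
  obtain ⟨π, hπ⟩ := CornerPart.exists_rel (fun j k => Reach S (corner n j) (corner n k))
    ⟨fun _ => Relation.ReflTransGen.refl, Reach.symm, Reach.trans⟩
  exact ⟨π, h, hπ⟩

/-- The union of three edge sets, placed in the three copies of `SG(n)`. -/
def glueEdges (n : ℕ) (S : Fin 3 → Finset (Sym2 (ℕ × ℕ))) : Finset (Sym2 (ℕ × ℕ)) :=
  Finset.univ.biUnion fun i => (S i).image (Sym2.map (shift n i))

theorem mem_glueEdges {n : ℕ} {S : Fin 3 → Finset (Sym2 (ℕ × ℕ))} {e : Sym2 (ℕ × ℕ)} :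
    e ∈ glueEdges n S ↔ ∃ i, ∃ d ∈ S i, d.map (shift n i) = e := by
  simp [glueEdges]

/-- One step in the graph of corners of the three copies; `(i, j)` stands for corner `j` of
copy `i`, which is also corner `i` of copy `j`. -/
def CornerStep (R : Fin 3 → Fin 3 → Fin 3 → Prop) (p q : Fin 3 × Fin 3) : Prop :=
  (p.1 = q.1 ∧ R p.1 p.2 q.2) ∨ q = p.swap

/-- Connectivity between corners of the three copies. -/
def CornerReach (R : Fin 3 → Fin 3 → Fin 3 → Prop) : Fin 3 × Fin 3 → Fin 3 × Fin 3 → Prop :=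
  Relation.ReflTransGen (CornerStep R)

theorem CornerReach.step_copy {R : Fin 3 → Fin 3 → Fin 3 → Prop} {p : Fin 3 × Fin 3}
    {i j k : Fin 3} (h : CornerReach R p (i, j)) (hR : R i j k) : CornerReach R p (i, k) :=
  h.tail (Or.inl ⟨rfl, hR⟩)

theorem CornerReach.step_swap {R : Fin 3 → Fin 3 → Fin 3 → Prop} {p : Fin 3 × Fin 3}
    {i j : Fin 3} (h : CornerReach R p (i, j)) : CornerReach R p (j, i) :=
  h.tail (Or.inr rfl)

section glue

variable {n : ℕ} {S : Fin 3 → Finset (Sym2 (ℕ × ℕ))}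

theorem Reach.shift {i : Fin 3} {u v : ℕ × ℕ} (h : Reach (S i) u v) :
    Reach (glueEdges n S) (shift n i u) (shift n i v) := by
  induction h with
  | refl => exact Relation.ReflTransGen.refl
  | tail _ huv ih => exact ih.tail (mem_glueEdges.2 ⟨i, _, huv, rfl⟩)

theorem reach_of_cornerReach {p q : Fin 3 × Fin 3}
    (h : CornerReach (fun i j k => Reach (S i) (corner n j) (corner n k)) p q) :
    Reach (glueEdges n S) (shift n p.1 (corner n p.2)) (shift n q.1 (corner n q.2)) := by
  induction h with
  | refl => exact Relation.ReflTransGen.refl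
  | tail _ h ih =>
    rcases h with ⟨h1, h2⟩ | rfl
    · rw [← h1]
      exact ih.trans h2.shift
    · rwa [Prod.fst_swap, Prod.snd_swap, shift_corner_comm n _ (Prod.fst _)]

/-- A path changes copies only at junctions, so its last stretch inside a copy starts at a corner of
that copy. The claim ranges over all representations of the endpoint, since a junction lies in two
copies and the next edge may use either; this makes the induction along the path close. -/
theorem cornerReach_of_reach (hS : ∀ i, S i ⊆ edges n) {p : Fin 3 × Fin 3} {v : ℕ × ℕ}
    (h : Reach (glueEdges n S) (shift n p.1 (corner n p.2)) v) :
    ∀ i, ∀ u ∈ verts n, shift n i u = v →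
      ∃ j, CornerReach (fun i j k => Reach (S i) (corner n j) (corner n k)) p (i, j) ∧
        Reach (S i) (corner n j) u := by
  induction h with
  | refl =>
    intro i u hu h
    by_cases hi : i = p.1
    · subst hi
      rw [shift_injective n _ h]
      exact ⟨p.2, Relation.ReflTransGen.refl, Relation.ReflTransGen.refl⟩
    · obtain ⟨h1, h2⟩ := eq_corner_of_shift_eq hi hu (corner_mem_verts n p.2) h
      have hp : p.2 = i := corner_injective n h2
      refine ⟨p.1, ?_, h1 ▸ Relation.ReflTransGen.refl⟩
      rw [← hp]
      exact CornerReach.step_swap Relation.ReflTransGen.refl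
  | @tail v w _ hvw ih =>
    intro i' u'' hu'' h
    obtain ⟨i, d, hd, hdv⟩ := mem_glueEdges.1 hvw
    obtain ⟨u, u', rfl, rfl, rfl⟩ : ∃ u u', d = s(u, u') ∧ shift n i u = v ∧ shift n i u' = w := by
      induction d with
      | _ a b =>
        rw [Sym2.map_mk, Sym2.eq_iff] at hdv
        rcases hdv with ⟨h1, h2⟩ | ⟨h1, h2⟩
        · exact ⟨a, b, rfl, h1, h2⟩
        · exact ⟨b, a, Sym2.eq_swap, h2, h1⟩
    have hu := mem_verts_of_mem_edges (hS i hd) (Sym2.mem_mk_left u u')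
    have hu' := mem_verts_of_mem_edges (hS i hd) (Sym2.mem_mk_right u u')
    obtain ⟨j, hj, hju⟩ := ih i u hu rfl
    have hju' : Reach (S i) (corner n j) u' := hju.tail hd
    by_cases hi : i' = i
    · subst hi
      rw [shift_injective n _ h]
      exact ⟨j, hj, hju'⟩
    · obtain ⟨h1, h2⟩ := eq_corner_of_shift_eq hi hu'' hu' h
      refine ⟨i, ?_, h1 ▸ Relation.ReflTransGen.refl⟩
      exact (hj.step_copy (k := i') (h2 ▸ hju')).step_swap

theorem reach_iff_cornerReach (hS : ∀ i, S i ⊆ edges n) (p q : Fin 3 × Fin 3) :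
    Reach (glueEdges n S) (shift n p.1 (corner n p.2)) (shift n q.1 (corner n q.2)) ↔
      CornerReach (fun i j k => Reach (S i) (corner n j) (corner n k)) p q := by
  refine ⟨fun h => ?_, reach_of_cornerReach⟩
  obtain ⟨j, h1, h2⟩ := cornerReach_of_reach hS h q.1 _ (corner_mem_verts n q.2) rfl
  exact h1.step_copy h2

/-- The partitions `ρ` of the corners of the three copies combine to the partition `π` of the
outer corners, and no block is cut off from the outer corners. -/
def Glues (ρ : Fin 3 → CornerPart) (π : CornerPart) : Prop :=
  (∀ p, ∃ l, CornerReach (fun i j k => (ρ i).rel j k = true) (l, l) p) ∧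
    ∀ j k, CornerReach (fun i j k => (ρ i).rel j k = true) (j, j) (k, k) ↔ π.rel j k = true

/-- Connectivity in the glued set is determined by the corner relations of the pieces. If every
vertex reaches an outer corner, the connecting path also attaches it to a corner of its own copy, so
each piece has a type. -/
theorem covers_glueEdges (hS : ∀ i, S i ⊆ edges n) (π : CornerPart) :
    Covers (n + 1) (glueEdges n S) π ↔ ∃ ρ : Fin 3 → CornerPart, (∀ i, Covers n (S i) (ρ i)) ∧
      Glues ρ π := by
  have key : ∀ ρ : Fin 3 → CornerPart, (∀ i, Covers n (S i) (ρ i)) → ∀ p q,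
      Reach (glueEdges n S) (shift n p.1 (corner n p.2)) (shift n q.1 (corner n q.2)) ↔
      CornerReach (fun i j k => (ρ i).rel j k = true) p q := by
    intro ρ hρ p q
    rw [reach_iff_cornerReach hS]
    simp only [(hρ _).reach_iff]
  constructor
  · intro h
    have hc : ∀ i, ∃ π, Covers n (S i) π := by
      intro i
      refine exists_covers fun v hv => ?_
      obtain ⟨l, hl⟩ := h.exists_corner _ (mem_verts_succ.2 ⟨i, v, hv, rfl⟩)
      rw [← shift_corner_self] at hl
      obtain ⟨j, -, hj⟩ := cornerReach_of_reach (p := (l, l)) hS hl i v hv rfl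
      exact ⟨j, hj⟩
    choose ρ hρ using hc
    refine ⟨ρ, hρ, fun p => ?_, fun j k => ?_⟩
    · obtain ⟨l, hl⟩ := h.exists_corner _
        (mem_verts_succ.2 ⟨p.1, _, corner_mem_verts n p.2, rfl⟩)
      rw [← shift_corner_self] at hl
      exact ⟨l, (key ρ hρ (l, l) p).1 hl⟩
    · rw [← key ρ hρ (j, j) (k, k), ← h.reach_iff]
      simp only [shift_corner_self]
  · rintro ⟨ρ, hρ, hg1, hg2⟩
    refine ⟨fun v hv => ?_, fun j k => ?_⟩
    · obtain ⟨i, u, hu, rfl⟩ := mem_verts_succ.1 hv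
      obtain ⟨j, hj⟩ := (hρ i).exists_corner u hu
      obtain ⟨l, hl⟩ := hg1 (i, j)
      rw [← key ρ hρ (l, l) (i, j), shift_corner_self] at hl
      exact ⟨l, hl.trans hj.shift⟩
    · rw [← hg2, ← key ρ hρ (j, j) (k, k)]
      simp only [shift_corner_self]

end glue

/-! ### Which triples of partitions glue -/

/-- The corners of the three copies that are connected with the outer corner `l`, computed
explicitly. The junctions are `(l, l + 1)`, `(l, l + 2)` and `(l + 1, l + 2)`. -/
def reached (ρ : Fin 3 → CornerPart) (l : Fin 3) (p : Fin 3 × Fin 3) : Bool :=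
  let x := (ρ l).rel l (l + 1)
  let y := (ρ l).rel l (l + 2)
  let xz := (ρ (l + 1)).rel l (l + 2)
  let yz := (ρ (l + 2)).rel l (l + 1)
  let rx := x || (y && yz && xz)
  let ry := y || (x && xz && yz)
  let rz := (x && xz) || (y && yz)
  if p.1 = l then (if p.2 = l then true else if p.2 = l + 1 then rx else ry)
  else if p.2 = l then (if p.1 = l + 1 then rx else ry)
  else if p.1 = p.2 then
    (if p.1 = l + 1 then
        (rx && (ρ (l + 1)).rel l (l + 1)) || (rz && (ρ (l + 1)).rel (l + 2) (l + 1))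
      else (ry && (ρ (l + 2)).rel l (l + 2)) || (rz && (ρ (l + 2)).rel (l + 1) (l + 2)))
  else rz

theorem reached_copy (a b c : CornerPart) : ∀ l i j k : Fin 3,
    reached ![a, b, c] l (i, j) = true → (![a, b, c] i).rel j k = true →
      reached ![a, b, c] l (i, k) = true := by
  revert a b c
  decide +kernel

theorem reached_swap (ρ : Fin 3 → CornerPart) (l : Fin 3) (p : Fin 3 × Fin 3) :
    reached ρ l p.swap = reached ρ l p := by
  obtain ⟨i, j⟩ := p
  fin_cases l <;> fin_cases i <;> fin_cases j <;> rfl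

/-- The three junctions lie on a cycle around the central hole. From `(l, l)`, a junction of copy
`l` is reached inside that copy or the long way round, and the opposite junction through either
neighbouring copy. -/
theorem cornerReach_of_reached {ρ : Fin 3 → CornerPart} {l : Fin 3} {p : Fin 3 × Fin 3}
    (h : reached ρ l p = true) :
    CornerReach (fun i j k => (ρ i).rel j k = true) (l, l) p := by
  have hl : ∀ l j : Fin 3, j ≠ l → j ≠ l + 1 → j = l + 2 := by decide
  have hsymm : ∀ (π : CornerPart) (j k : Fin 3), π.rel j k = true → π.rel k j = true := by decide
  have h0 : CornerReach (fun i j k => (ρ i).rel j k = true) (l, l) (l, l) :=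
    Relation.ReflTransGen.refl
  obtain ⟨i, j⟩ := p
  simp only [reached] at h
  set x := (ρ l).rel l (l + 1) with hx
  set y := (ρ l).rel l (l + 2) with hy
  set xz := (ρ (l + 1)).rel l (l + 2) with hxz
  set yz := (ρ (l + 2)).rel l (l + 1) with hyz
  have rz : (x && xz || y && yz) = true →
      CornerReach (fun i j k => (ρ i).rel j k = true) (l, l) (l + 1, l + 2) := by
    simp only [Bool.or_eq_true, Bool.and_eq_true]
    rintro (⟨h1, h2⟩ | ⟨h1, h2⟩)
    · exact (h0.step_copy h1).step_swap.step_copy h2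
    · exact ((h0.step_copy h1).step_swap.step_copy h2).step_swap
  have rx : (x || (y && yz && xz)) = true →
      CornerReach (fun i j k => (ρ i).rel j k = true) (l, l) (l, l + 1) := by
    simp only [Bool.or_eq_true, Bool.and_eq_true]
    rintro (h1 | ⟨⟨h1, h2⟩, h3⟩)
    · exact h0.step_copy h1
    · exact ((rz (by simp [h1, h2])).step_copy (hsymm _ _ _ h3)).step_swap
  have ry : (y || (x && xz && yz)) = true →
      CornerReach (fun i j k => (ρ i).rel j k = true) (l, l) (l, l + 2) := by
    simp only [Bool.or_eq_true, Bool.and_eq_true]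
    rintro (h1 | ⟨⟨h1, h2⟩, h3⟩)
    · exact h0.step_copy h1
    · exact ((rz (by simp [h1, h2])).step_swap.step_copy (hsymm _ _ _ h3)).step_swap
  split_ifs at h with h1 h2 h3 h2 h3 h4 h5
  · rw [h1, h2]; exact h0
  · rw [h1, h3]; exact rx h
  · rw [h1, hl l j h2 h3]; exact ry h
  · rw [h2, h3]; exact (rx h).step_swap
  · rw [h2, hl l i h1 h3]; exact (ry h).step_swap
  · rw [← h4, h5]
    rw [Bool.or_eq_true, Bool.and_eq_true, Bool.and_eq_true] at h
    rcases h with ⟨h6, h7⟩ | ⟨h6, h7⟩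
    · exact (rx h6).step_swap.step_copy h7
    · exact (rz h6).step_copy h7
  · rw [← h4, hl l i h1 h5]
    rw [Bool.or_eq_true, Bool.and_eq_true, Bool.and_eq_true] at h
    rcases h with ⟨h6, h7⟩ | ⟨h6, h7⟩
    · exact (ry h6).step_swap.step_copy h7
    · exact (rz h6).step_swap.step_copy h7
  · by_cases h5 : i = l + 1
    · rw [h5, hl l j h2 (fun h6 => h4 (h5.trans h6.symm))]; exact rz h
    · have h6 : j = l + 1 := by
        by_contra h6
        exact h4 ((hl l i h1 h5).trans (hl l j h2 h6).symm)
      rw [h6, hl l i h1 h5]; exact (rz h).step_swap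

/-- The set described by `reached` contains the start, is closed under both kinds of steps, and each
of its members has an explicit path. This makes `Glues` decidable. -/
theorem cornerReach_iff_reached (a b c : CornerPart) (l : Fin 3) (p : Fin 3 × Fin 3) :
    CornerReach (fun i j k => (![a, b, c] i).rel j k = true) (l, l) p ↔
      reached ![a, b, c] l p = true := by
  refine ⟨fun h => ?_, cornerReach_of_reached⟩
  induction h with
  | refl => simp [reached]
  | @tail p q _ h ih =>
    obtain ⟨i, j⟩ := p
    obtain ⟨i', k⟩ := q
    rcases h with ⟨h1, h2⟩ | h
    · obtain rfl : i = i' := h1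
      exact reached_copy a b c l i j k ih h2
    · rw [h, reached_swap, ih]

/-- Decision procedure for `Glues`. -/
def gluesBool (a b c π : CornerPart) : Bool :=
  decide ((∀ i j, ∃ l, reached ![a, b, c] l (i, j) = true) ∧
    ∀ j k, reached ![a, b, c] j (k, k) = π.rel j k)

theorem glues_iff (a b c π : CornerPart) : Glues ![a, b, c] π ↔ gluesBool a b c π = true := by
  simp only [Glues, cornerReach_iff_reached, gluesBool, decide_eq_true_eq, Prod.forall,
    ← Bool.eq_iff_iff]

/-- The triples that glue to `π` without creating a cycle. -/
def admissible (π : CornerPart) : Finset (CornerPart × CornerPart × CornerPart) :=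
  Finset.univ.filter fun t => gluesBool t.1 t.2.1 t.2.2 π = true ∧
    t.1.blocks + t.2.1.blocks + t.2.2.blocks = 3 + π.blocks

/-- Each of the three identifications of corners merges at most two blocks; equality means that no
cycle closes. -/
theorem blocks_le_of_glues : ∀ a b c π : CornerPart, gluesBool a b c π = true →
    a.blocks + b.blocks + c.blocks ≤ 3 + π.blocks := by
  decide +kernel

-- The enumeration is stated for three independent functions because the mark is seen differently by
-- the three copies.
open CornerPart in
theorem sum_admissible_tree (u v w : CornerPart → ℝ) :
    ∑ t ∈ admissible tree, u t.1 * v t.2.1 * w t.2.2 =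
    u tree * v tree * w (iso 0) + u tree * v tree * w (iso 1) + u tree * v (iso 0) * w tree +
      u tree * v (iso 2) * w tree + u (iso 1) * v tree * w tree + u (iso 2) * v tree * w tree := by
  have h : admissible tree =
    {(tree, tree, iso 0), (tree, tree, iso 1), (tree, iso 0, tree), (tree, iso 2, tree), (iso
      1, tree, tree), (iso 2, tree, tree)} := by
    decide +kernel
  rw [h]
  simp [add_assoc]

open CornerPart in
theorem sum_admissible_iso_zero (u v w : CornerPart → ℝ) :
    ∑ t ∈ admissible (iso 0), u t.1 * v t.2.1 * w t.2.2 =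
    u tree * v (iso 0) * w (iso 0) + u (iso 0) * v tree * w (iso 0) + u (iso 0) * v tree * w
      (iso 1) + u (iso 0) * v (iso 0) * w tree + u (iso 0) * v (iso 2) * w tree + u (iso 1) *
      v tree * w (iso 0) + u (iso 2) * v (iso 0) * w tree + u discrete * v tree * w tree := by
  have h : admissible (iso 0) =
    {(tree, iso 0, iso 0), (iso 0, tree, iso 0), (iso 0, tree, iso 1), (iso 0, iso 0, tree),
      (iso 0, iso 2, tree), (iso 1, tree, iso 0), (iso 2, iso 0, tree), (discrete, tree,
      tree)} := by
    decide +kernel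
  rw [h]
  simp [add_assoc]

open CornerPart in
theorem sum_admissible_iso_one (u v w : CornerPart → ℝ) :
    ∑ t ∈ admissible (iso 1), u t.1 * v t.2.1 * w t.2.2 =
    u tree * v (iso 0) * w (iso 1) + u tree * v (iso 1) * w (iso 0) + u tree * v (iso 1) * w
      (iso 1) + u tree * v discrete * w tree + u (iso 1) * v tree * w (iso 1) + u (iso 1) * v
      (iso 1) * w tree + u (iso 1) * v (iso 2) * w tree + u (iso 2) * v (iso 1) * w tree := by
  have h : admissible (iso 1) =
    {(tree, iso 0, iso 1), (tree, iso 1, iso 0), (tree, iso 1, iso 1), (tree, discrete, tree),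
      (iso 1, tree, iso 1), (iso 1, iso 1, tree), (iso 1, iso 2, tree), (iso 2, iso 1, tree)} := by
    decide +kernel
  rw [h]
  simp [add_assoc]

open CornerPart in
theorem sum_admissible_iso_two (u v w : CornerPart → ℝ) :
    ∑ t ∈ admissible (iso 2), u t.1 * v t.2.1 * w t.2.2 =
    u tree * v tree * w discrete + u tree * v (iso 0) * w (iso 2) + u tree * v (iso 2) * w
      (iso 0) + u tree * v (iso 2) * w (iso 2) + u (iso 1) * v tree * w (iso 2) + u (iso 2) *
      v tree * w (iso 1) + u (iso 2) * v tree * w (iso 2) + u (iso 2) * v (iso 2) * w tree := by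
  have h : admissible (iso 2) =
    {(tree, tree, discrete), (tree, iso 0, iso 2), (tree, iso 2, iso 0), (tree, iso 2, iso 2),
      (iso 1, tree, iso 2), (iso 2, tree, iso 1), (iso 2, tree, iso 2), (iso 2, iso 2, tree)} := by
    decide +kernel
  rw [h]
  simp [add_assoc]

open CornerPart in
theorem sum_admissible_discrete (u v w : CornerPart → ℝ) :
    ∑ t ∈ admissible discrete, u t.1 * v t.2.1 * w t.2.2 =
    u tree * v (iso 0) * w discrete + u tree * v (iso 1) * w discrete + u tree * v discrete *
      w (iso 0) + u tree * v discrete * w (iso 2) + u (iso 0) * v tree * w discrete + u (iso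
      0) * v (iso 0) * w (iso 1) + u (iso 0) * v (iso 0) * w (iso 2) + u (iso 0) * v (iso 1) *
      w (iso 0) + u (iso 0) * v (iso 1) * w (iso 1) + u (iso 0) * v (iso 2) * w (iso 0) + u
      (iso 0) * v (iso 2) * w (iso 2) + u (iso 0) * v discrete * w tree + u (iso 1) * v tree *
      w discrete + u (iso 1) * v (iso 1) * w (iso 0) + u (iso 1) * v (iso 1) * w (iso 2) + u
      (iso 1) * v (iso 2) * w (iso 0) + u (iso 1) * v (iso 2) * w (iso 2) + u (iso 2) * v (iso
      0) * w (iso 1) + u (iso 2) * v (iso 0) * w (iso 2) + u (iso 2) * v (iso 1) * w (iso 1) +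
      u (iso 2) * v (iso 1) * w (iso 2) + u (iso 2) * v discrete * w tree + u discrete * v
      tree * w (iso 1) + u discrete * v tree * w (iso 2) + u discrete * v (iso 1) * w tree + u
      discrete * v (iso 2) * w tree := by
  have h : admissible discrete =
    {(tree, iso 0, discrete), (tree, iso 1, discrete), (tree, discrete, iso 0), (tree,
      discrete, iso 2), (iso 0, tree, discrete), (iso 0, iso 0, iso 1), (iso 0, iso 0, iso 2),
      (iso 0, iso 1, iso 0), (iso 0, iso 1, iso 1), (iso 0, iso 2, iso 0), (iso 0, iso 2, iso
      2), (iso 0, discrete, tree), (iso 1, tree, discrete), (iso 1, iso 1, iso 0), (iso 1, iso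
      1, iso 2), (iso 1, iso 2, iso 0), (iso 1, iso 2, iso 2), (iso 2, iso 0, iso 1), (iso 2,
      iso 0, iso 2), (iso 2, iso 1, iso 1), (iso 2, iso 1, iso 2), (iso 2, discrete, tree),
      (discrete, tree, iso 1), (discrete, tree, iso 2), (discrete, iso 1, tree), (discrete,
      iso 2, tree)} := by
    decide +kernel
  rw [h]
  simp [add_assoc]

/-! ### The triangle `SG(0)` -/

section base

theorem mem_edges_zero {u v : ℕ × ℕ} (h : s(u, v) ∈ edges 0) :
    ∃ j k, u = corner 0 j ∧ v = corner 0 k := by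
  have hv : ∀ p ∈ verts 0, ∃ j, p = corner 0 j := by decide
  obtain ⟨j, hj⟩ := hv u (mem_verts_of_mem_edges h (Sym2.mem_mk_left u v))
  obtain ⟨k, hk⟩ := hv v (mem_verts_of_mem_edges h (Sym2.mem_mk_right u v))
  exact ⟨j, k, hj, hk⟩

/-- Connectivity by at most two edges between corners of the triangle. -/
def TriangleReach (S : Finset (Sym2 (ℕ × ℕ))) (j k : Fin 3) : Prop :=
  j = k ∨ s(corner 0 j, corner 0 k) ∈ S ∨
    ∃ l, s(corner 0 j, corner 0 l) ∈ S ∧ s(corner 0 l, corner 0 k) ∈ S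

instance (S : Finset (Sym2 (ℕ × ℕ))) (j k : Fin 3) : Decidable (TriangleReach S j k) :=
  inferInstanceAs (Decidable (_ ∨ _ ∨ _))

theorem triangleReach_step : ∀ S ∈ (edges 0).powerset, ∀ j k l, TriangleReach S j k →
    s(corner 0 k, corner 0 l) ∈ S → TriangleReach S j l := by
  decide +kernel

theorem reach_zero_iff {S : Finset (Sym2 (ℕ × ℕ))} (hS : S ⊆ edges 0) (j k : Fin 3) :
    Reach S (corner 0 j) (corner 0 k) ↔ TriangleReach S j k := by
  constructor
  · intro h
    have key : ∀ v, Reach S (corner 0 j) v → ∃ k, v = corner 0 k ∧ TriangleReach S j k := by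
      intro v hv
      induction hv with
      | refl => exact ⟨j, rfl, Or.inl rfl⟩
      | tail _ hvw ih =>
        obtain ⟨k, rfl, hk⟩ := ih
        obtain ⟨-, l, -, rfl⟩ := mem_edges_zero (hS hvw)
        exact ⟨l, rfl, triangleReach_step S (Finset.mem_powerset.2 hS) j k l hk hvw⟩
    obtain ⟨k', hk, h'⟩ := key _ h
    rwa [corner_injective 0 hk]
  · rintro (rfl | h | ⟨l, h1, h2⟩)
    · exact Relation.ReflTransGen.refl
    · exact Relation.ReflTransGen.single h
    · exact (Relation.ReflTransGen.single h1).tail h2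

theorem covers_zero_iff {S : Finset (Sym2 (ℕ × ℕ))} (hS : S ⊆ edges 0) (π : CornerPart) :
    Covers 0 S π ↔ ∀ j k, TriangleReach S j k ↔ π.rel j k = true := by
  simp only [← reach_zero_iff hS]
  refine ⟨fun h => h.reach_iff, fun h => ⟨fun v hv => ?_, h⟩⟩
  have hv' : ∀ p ∈ verts 0, ∃ j, p = corner 0 j := by decide
  obtain ⟨j, rfl⟩ := hv' v hv
  exact ⟨j, Relation.ReflTransGen.refl⟩

theorem card_verts_zero : (verts 0).card = 3 := by decide

end base

/-! ### Decomposition of forests into three pieces -/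

section decomposition

variable {n : ℕ} {S : Fin 3 → Finset (Sym2 (ℕ × ℕ))}

theorem glueEdges_subset (hS : ∀ i, S i ⊆ edges n) : glueEdges n S ⊆ edges (n + 1) := by
  intro e he
  obtain ⟨i, d, hd, rfl⟩ := mem_glueEdges.1 he
  exact mem_edges_succ.2 ⟨i, d, hS i hd, rfl⟩

/-- The part of an edge set that lies in the `i`-th copy of `SG(n)`. -/
def restrictEdges (n : ℕ) (S : Finset (Sym2 (ℕ × ℕ))) (i : Fin 3) : Finset (Sym2 (ℕ × ℕ)) :=
  (edges n).filter fun d => d.map (shift n i) ∈ S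

theorem restrictEdges_subset (n : ℕ) (S : Finset (Sym2 (ℕ × ℕ))) (i : Fin 3) :
    restrictEdges n S i ⊆ edges n := Finset.filter_subset _ _

theorem glueEdges_restrictEdges {S : Finset (Sym2 (ℕ × ℕ))} (hS : S ⊆ edges (n + 1)) :
    glueEdges n (restrictEdges n S) = S := by
  ext e
  rw [mem_glueEdges]
  constructor
  · rintro ⟨i, d, hd, rfl⟩
    exact (Finset.mem_filter.1 hd).2
  · intro he
    obtain ⟨i, d, hd, rfl⟩ := mem_edges_succ.1 (hS he)
    exact ⟨i, d, Finset.mem_filter.2 ⟨hd, he⟩, rfl⟩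

/-- Since the copies share no edge, gluing loses no information; with `glueEdges_restrictEdges` this
gives a bijection between edge sets and triples. -/
theorem restrictEdges_glueEdges (hS : ∀ i, S i ⊆ edges n) :
    restrictEdges n (glueEdges n S) = S := by
  funext i
  ext e
  rw [restrictEdges, Finset.mem_filter, mem_glueEdges]
  constructor
  · rintro ⟨he, j, d, hd, h⟩
    by_cases hij : j = i
    · subst hij
      rwa [← map_shift_injective n _ h]
    · exact absurd h (map_shift_ne hij (hS j hd) he)
  · exact fun he => ⟨hS i he, i, e, he, rfl⟩

theorem prod_glueEdges (hS : ∀ i, S i ⊆ edges n) {M : Type*} [CommMonoid M]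
    (w : Sym2 (ℕ × ℕ) → M) :
    ∏ e ∈ glueEdges n S, w e = ∏ i, ∏ e ∈ S i, w (e.map (shift n i)) := by
  rw [glueEdges, Finset.prod_biUnion]
  · exact Finset.prod_congr rfl fun i _ =>
      Finset.prod_image fun _ _ _ _ h => map_shift_injective n i h
  · intro i _ j _ hij
    rw [Function.onFun, Finset.disjoint_left]
    intro e he he'
    obtain ⟨d, hd, rfl⟩ := Finset.mem_image.1 he
    obtain ⟨d', hd', h⟩ := Finset.mem_image.1 he'
    exact map_shift_ne hij (hS i hd) (hS j hd') h.symm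

theorem card_glueEdges (hS : ∀ i, S i ⊆ edges n) :
    (glueEdges n S).card = (S 0).card + (S 1).card + (S 2).card := by
  -- Counting edges is the product formula for a constant weight in the multiplicative copy of the
  -- naturals.
  have h := prod_glueEdges hS (fun _ => Multiplicative.ofAdd 1)
  simp only [Finset.prod_const, Fin.prod_univ_three] at h
  simpa [← ofAdd_nsmul, ← ofAdd_add] using h

theorem eq_triple (ρ : Fin 3 → CornerPart) : ρ = ![ρ 0, ρ 1, ρ 2] := by
  funext i; fin_cases i <;> rfl

/-- An edge set whose components cover all vertices has at least as many edges as a forest. -/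
theorem Covers.card_verts_le {S : Finset (Sym2 (ℕ × ℕ))} (hS : S ⊆ edges n) {π : CornerPart}
    (h : Covers n S π) : (verts n).card ≤ S.card + π.blocks := by
  induction n generalizing S π with
  | zero =>
    have key : ∀ S ∈ (edges 0).powerset, ∀ π : CornerPart,
        (∀ j k, TriangleReach S j k ↔ π.rel j k = true) → 3 ≤ S.card + π.blocks := by
      decide +kernel
    rw [card_verts_zero]
    exact key S (Finset.mem_powerset.2 hS) π ((covers_zero_iff hS π).1 h)
  | succ n ih =>
    have hR := restrictEdges_subset n S
    rw [← glueEdges_restrictEdges hS] at h ⊢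
    obtain ⟨ρ, hρ, hg⟩ := (covers_glueEdges hR π).1 h
    rw [eq_triple ρ, glues_iff] at hg
    have h0 := ih (hR 0) (hρ 0)
    have h1 := ih (hR 1) (hρ 1)
    have h2 := ih (hR 2) (hρ 2)
    have hb := blocks_le_of_glues _ _ _ _ hg
    have hc := card_verts_succ n
    rw [card_glueEdges hR]
    omega

/-- The edge sets of spanning forests in which every component contains a corner, and `π` is the
partition of the corners induced by the components. -/
structure IsForest (n : ℕ) (S : Finset (Sym2 (ℕ × ℕ))) (π : CornerPart) : Prop
    extends Covers n S π where
  card_eq : S.card + π.blocks = (verts n).card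

/-- Being a forest is encoded by the edge count, so cycles need no separate treatment.
`Covers.card_verts_le` for the three pieces and `blocks_le_of_glues` add up to an inequality which
the edge count of the whole turns into an equality; hence every piece is a forest and the block
counts match. -/
theorem isForest_glueEdges (hS : ∀ i, S i ⊆ edges n) (π : CornerPart) :
    IsForest (n + 1) (glueEdges n S) π ↔
      ∃ t ∈ admissible π, ∀ i, IsForest n (S i) (![t.1, t.2.1, t.2.2] i) := by
  have hc := card_verts_succ n
  have hS' := card_glueEdges hS
  constructor
  · rintro ⟨h, hcard⟩
    obtain ⟨ρ, hρ, hg⟩ := (covers_glueEdges hS π).1 h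
    rw [eq_triple ρ, glues_iff] at hg
    have h0 := (hρ 0).card_verts_le (hS 0)
    have h1 := (hρ 1).card_verts_le (hS 1)
    have h2 := (hρ 2).card_verts_le (hS 2)
    have hb := blocks_le_of_glues _ _ _ _ hg
    refine ⟨(ρ 0, ρ 1, ρ 2), ?_, fun i => ?_⟩
    · rw [admissible, Finset.mem_filter]
      refine ⟨Finset.mem_univ _, hg, ?_⟩
      dsimp only
      omega
    · rw [← eq_triple ρ]
      refine ⟨hρ i, ?_⟩
      fin_cases i <;> simp only [Fin.zero_eta, Fin.mk_one, Fin.reduceFinMk] <;> omega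
  · rintro ⟨⟨a, b, c⟩, ht, h⟩
    obtain ⟨-, hg, hb⟩ := Finset.mem_filter.1 ht
    refine ⟨(covers_glueEdges hS π).2 ⟨_, fun i => (h i).toCovers, (glues_iff _ _ _ _).2 hg⟩, ?_⟩
    have h0 := (h 0).card_eq
    have h1 := (h 1).card_eq
    have h2 := (h 2).card_eq
    simp only [Matrix.cons_val_zero, Matrix.cons_val_one, Matrix.cons_val] at h0 h1 h2
    dsimp only at hb
    omega

end decomposition

/-! ### Weighted forest sums: recursion and initial values -/

open scoped Classical in
/-- The weighted number of spanning forests of type `π`. -/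
noncomputable def forestSum (w : Sym2 (ℕ × ℕ) → ℝ) (n : ℕ) (π : CornerPart) : ℝ :=
  ∑ S ∈ (edges n).powerset, if IsForest n S π then ∏ e ∈ S, w e else 0

theorem forestSum_congr {w w' : Sym2 (ℕ × ℕ) → ℝ} {n : ℕ} (h : ∀ e ∈ edges n, w e = w' e) :
    forestSum w n = forestSum w' n := by
  funext π
  refine Finset.sum_congr rfl fun S hS => ?_
  rw [Finset.prod_congr rfl fun e he => h e (Finset.mem_powerset.1 hS he)]

/-- The bijection with triples and multiplicativity of the weight turn the sum over edge sets into a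
sum of products. -/
theorem forestSum_succ (w : Sym2 (ℕ × ℕ) → ℝ) (n : ℕ) (π : CornerPart) :
    forestSum w (n + 1) π = ∑ t ∈ admissible π,
      forestSum (fun e => w (e.map (shift n 0))) n t.1 *
      forestSum (fun e => w (e.map (shift n 1))) n t.2.1 *
      forestSum (fun e => w (e.map (shift n 2))) n t.2.2 := by
  classical
  have hterm : ∀ S : Fin 3 → Finset (Sym2 (ℕ × ℕ)), (∀ i, S i ⊆ edges n) →
      (if IsForest (n + 1) (glueEdges n S) π then ∏ e ∈ glueEdges n S, w e else 0) =
      ∑ t ∈ admissible π, ∏ i, if IsForest n (S i) (![t.1, t.2.1, t.2.2] i) then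
        ∏ e ∈ S i, w (e.map (shift n i)) else 0 := by
    intro S hS
    rw [isForest_glueEdges hS, prod_glueEdges hS]
    have hprod : ∀ t : CornerPart × CornerPart × CornerPart,
        (∏ i, if IsForest n (S i) (![t.1, t.2.1, t.2.2] i) then
          ∏ e ∈ S i, w (e.map (shift n i)) else 0) =
        if ∀ i, IsForest n (S i) (![t.1, t.2.1, t.2.2] i) then
          ∏ i, ∏ e ∈ S i, w (e.map (shift n i)) else 0 := by
      intro t
      split_ifs with h
      · exact Finset.prod_congr rfl fun i _ => if_pos (h i)
      · push Not at h
        obtain ⟨i, hi⟩ := h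
        exact Finset.prod_eq_zero (Finset.mem_univ i) (if_neg hi)
    simp only [hprod]
    split_ifs with h
    · obtain ⟨t, ht, h⟩ := h
      rw [Finset.sum_eq_single_of_mem t ht, if_pos h]
      -- The types of the pieces are determined by the edge sets, so only one triple contributes.
      intro t' _ hne
      refine if_neg fun h' => hne ?_
      have h0 := (h' 0).toCovers.unique (h 0).toCovers
      have h1 := (h' 1).toCovers.unique (h 1).toCovers
      have h2 := (h' 2).toCovers.unique (h 2).toCovers
      exact Prod.ext h0 (Prod.ext h1 h2)
    · symm
      refine Finset.sum_eq_zero fun t ht => if_neg fun h' => h ⟨t, ht, h'⟩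
  have hbij : forestSum w (n + 1) π = ∑ S ∈ Fintype.piFinset fun _ : Fin 3 => (edges n).powerset,
      if IsForest (n + 1) (glueEdges n S) π then ∏ e ∈ glueEdges n S, w e else 0 := by
    refine Finset.sum_nbij' (restrictEdges n) (glueEdges n) ?_ ?_ ?_ ?_ ?_
    · intro S _
      exact Fintype.mem_piFinset.2 fun i => Finset.mem_powerset.2 (restrictEdges_subset n S i)
    · intro S hS
      exact Finset.mem_powerset.2 (glueEdges_subset fun i =>
        Finset.mem_powerset.1 (Fintype.mem_piFinset.1 hS i))
    · intro S hS
      exact glueEdges_restrictEdges (Finset.mem_powerset.1 hS)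
    · intro S hS
      exact restrictEdges_glueEdges fun i =>
        Finset.mem_powerset.1 (Fintype.mem_piFinset.1 hS i)
    · intro S hS
      rw [glueEdges_restrictEdges (Finset.mem_powerset.1 hS)]
  rw [hbij, Finset.sum_congr rfl fun S hS => hterm S fun i =>
    Finset.mem_powerset.1 (Fintype.mem_piFinset.1 hS i), Finset.sum_comm]
  refine Finset.sum_congr rfl fun t _ => ?_
  rw [← Finset.prod_univ_sum (fun _ : Fin 3 => (edges n).powerset)
    (fun i S => if IsForest n S (![t.1, t.2.1, t.2.2] i) then
        ∏ e ∈ S, w (e.map (shift n i)) else 0), Fin.prod_univ_three]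
  rfl

theorem forestSum_zero (w : Sym2 (ℕ × ℕ) → ℝ) (π : CornerPart) {s : Finset (Finset (Sym2 (ℕ × ℕ)))}
    (h : (edges 0).powerset.filter (fun S =>
      (∀ j k, TriangleReach S j k ↔ π.rel j k = true) ∧ S.card + π.blocks = 3) = s) :
    forestSum w 0 π = ∑ S ∈ s, ∏ e ∈ S, w e := by
  classical
  rw [forestSum, ← Finset.sum_filter, ← h]
  refine Finset.sum_congr (Finset.filter_congr fun S hS => ?_) fun _ _ => rfl
  rw [← covers_zero_iff (Finset.mem_powerset.1 hS), ← card_verts_zero]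
  exact ⟨fun h => ⟨h.1, h.2⟩, fun h => ⟨h.1, h.2⟩⟩

/-- The edge of the triangle `SG(0)` joining two corners. -/
abbrev side (j k : Fin 3) : Sym2 (ℕ × ℕ) := s(corner 0 j, corner 0 k)

theorem forestSum_zero_tree (w : Sym2 (ℕ × ℕ) → ℝ) : forestSum w 0 .tree =
    w (side 0 1) * w (side 0 2) + w (side 0 1) * w (side 1 2) + w (side 0 2) * w (side 1 2) := by
  rw [forestSum_zero w _ (s := {{side 0 1, side 0 2}, {side 0 1, side 1 2}, {side 0 2, side 1 2}})
    (by decide +kernel)]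
  rw [Finset.sum_insert (by decide), Finset.sum_insert (by decide), Finset.sum_singleton,
    Finset.prod_pair (by decide), Finset.prod_pair (by decide), Finset.prod_pair (by decide),
    add_assoc]

theorem forestSum_zero_iso_zero (w : Sym2 (ℕ × ℕ) → ℝ) :
    forestSum w 0 (.iso 0) = w (side 1 2) := by
  rw [forestSum_zero w _ (s := {{side 1 2}}) (by decide +kernel), Finset.sum_singleton,
    Finset.prod_singleton]

theorem forestSum_zero_iso_one (w : Sym2 (ℕ × ℕ) → ℝ) :
    forestSum w 0 (.iso 1) = w (side 0 2) := by
  rw [forestSum_zero w _ (s := {{side 0 2}}) (by decide +kernel), Finset.sum_singleton,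
    Finset.prod_singleton]

theorem forestSum_zero_iso_two (w : Sym2 (ℕ × ℕ) → ℝ) :
    forestSum w 0 (.iso 2) = w (side 0 1) := by
  rw [forestSum_zero w _ (s := {{side 0 1}}) (by decide +kernel), Finset.sum_singleton,
    Finset.prod_singleton]

theorem forestSum_zero_discrete (w : Sym2 (ℕ × ℕ) → ℝ) : forestSum w 0 .discrete = 1 := by
  rw [forestSum_zero w _ (s := {∅}) (by decide +kernel), Finset.sum_singleton, Finset.prod_empty]

/-! ### Spanning trees as edge sets -/

section bridge

variable {n : ℕ} {S : Finset (Sym2 (ℕ × ℕ))}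

/-- The spanning subgraph of `SG(n)` with edge set `S`. -/
def edgeGraph (n : ℕ) (S : Finset (Sym2 (ℕ × ℕ))) : SimpleGraph (Vertex n) :=
  (SimpleGraph.fromEdgeSet (S : Set (Sym2 (ℕ × ℕ)))).comap Subtype.val

theorem edgeGraph_adj (hS : S ⊆ edges n) {u v : Vertex n} :
    (edgeGraph n S).Adj u v ↔ s(u.1, v.1) ∈ S := by
  rw [edgeGraph, SimpleGraph.comap_adj, SimpleGraph.fromEdgeSet_adj, Finset.mem_coe,
    and_iff_left_iff_imp]
  intro h huv
  exact not_isDiag_of_mem_edges (hS h) (Sym2.mk_isDiag_iff.2 huv)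

theorem edgeGraph_le (hS : S ⊆ edges n) : edgeGraph n S ≤ SG n := by
  intro u v h
  exact SimpleGraph.fromEdgeSet_mono (Finset.coe_subset.2 hS) h

theorem image_edgeSet_edgeGraph (hS : S ⊆ edges n) :
    Sym2.map Subtype.val '' (edgeGraph n S).edgeSet = (S : Set (Sym2 (ℕ × ℕ))) := by
  ext e
  constructor
  · rintro ⟨d, hd, rfl⟩
    induction d with
    | _ u v => exact (edgeGraph_adj hS).1 hd
  · intro he
    induction e with
    | _ u v =>
      have hu := mem_verts_of_mem_edges (hS he) (Sym2.mem_mk_left u v)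
      have hv := mem_verts_of_mem_edges (hS he) (Sym2.mem_mk_right u v)
      exact ⟨s(⟨u, hu⟩, ⟨v, hv⟩), (edgeGraph_adj (u := ⟨u, hu⟩) (v := ⟨v, hv⟩) hS).2 he, rfl⟩

theorem exists_edgeGraph_eq {T : SimpleGraph (Vertex n)} (hT : T ≤ SG n) :
    ∃ S ⊆ edges n, edgeGraph n S = T := by
  classical
  refine ⟨(edges n).filter fun e => e ∈ Sym2.map Subtype.val '' T.edgeSet,
    Finset.filter_subset _ _, ?_⟩
  ext u v
  rw [edgeGraph_adj (Finset.filter_subset _ _), Finset.mem_filter]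
  constructor
  · rintro ⟨-, d, hd, h⟩
    have h' : d = s(u, v) := Sym2.map.injective Subtype.val_injective h
    rwa [h'] at hd
  · intro h
    exact ⟨(edgeGraph_adj (Finset.Subset.refl _)).1 (hT h), s(u, v), h, rfl⟩

theorem edgeGraph_injOn : Set.InjOn (edgeGraph n) {S | S ⊆ edges n} := by
  intro S hS S' hS' h
  rw [← Finset.coe_inj, ← image_edgeSet_edgeGraph hS, ← image_edgeSet_edgeGraph hS', h]

theorem card_edgeSet_edgeGraph (hS : S ⊆ edges n) : Nat.card (edgeGraph n S).edgeSet = S.card := by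
  rw [Nat.card_coe_set_eq, ← Set.ncard_image_of_injective _
    (Sym2.map.injective Subtype.val_injective), image_edgeSet_edgeGraph hS, Set.ncard_coe_finset]

theorem edgeGraph_reachable (hS : S ⊆ edges n) (u v : Vertex n) :
    (edgeGraph n S).Reachable u v ↔ Reach S u.1 v.1 := by
  rw [SimpleGraph.reachable_iff_reflTransGen]
  constructor
  · intro h
    induction h with
    | refl => exact Relation.ReflTransGen.refl
    | tail _ h ih => exact ih.tail ((edgeGraph_adj hS).1 h)
  · intro h
    have key : ∀ p, Reach S u.1 p → ∃ hp : p ∈ verts n,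
        Relation.ReflTransGen (edgeGraph n S).Adj u ⟨p, hp⟩ := by
      intro p hp
      induction hp with
      | refl => exact ⟨u.2, Relation.ReflTransGen.refl⟩
      | tail _ h ih =>
        obtain ⟨h1, h2⟩ := ih
        exact ⟨mem_verts_of_mem_edges (hS h) (Sym2.mem_mk_right _ _),
          h2.tail ((edgeGraph_adj hS).2 h)⟩
    exact (key _ h).2

/-- A tree is a connected graph with one edge fewer than vertices, and `CornerPart.tree` has one
block. -/
theorem edgeGraph_isTree (hS : S ⊆ edges n) :
    (edgeGraph n S).IsTree ↔ IsForest n S .tree := by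
  have hV : Nat.card (Vertex n) = (verts n).card := by simp
  rw [SimpleGraph.isTree_iff_connected_and_card, card_edgeSet_edgeGraph hS, hV]
  constructor
  · rintro ⟨hc, hcard⟩
    have hr : ∀ u ∈ verts n, ∀ v ∈ verts n, Reach S u v := fun u hu v hv =>
      (edgeGraph_reachable hS ⟨u, hu⟩ ⟨v, hv⟩).1 (hc.preconnected _ _)
    exact ⟨⟨fun v hv => ⟨0, hr _ (corner_mem_verts n 0) _ hv⟩, fun j k =>
      iff_of_true (hr _ (corner_mem_verts n j) _ (corner_mem_verts n k)) rfl⟩, hcard⟩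
  · rintro ⟨⟨h1, h2⟩, hcard⟩
    have hr : ∀ v ∈ verts n, Reach S (corner n 0) v := by
      intro v hv
      obtain ⟨j, hj⟩ := h1 v hv
      exact ((h2 0 j).2 rfl).trans hj
    have : Nonempty (Vertex n) := ⟨⟨_, corner_mem_verts n 0⟩⟩
    exact ⟨⟨fun u v => (edgeGraph_reachable hS u v).2 ((hr _ u.2).symm.trans (hr _ v.2))⟩, hcard⟩

theorem ncard_neighborSet_edgeGraph (hS : S ⊆ edges n) (x : Vertex n) :
    ((edgeGraph n S).neighborSet x).ncard = (S.filter fun e => x.1 ∈ e).card := by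
  have hinj : Function.Injective fun v : Vertex n => s(x.1, v.1) := fun u v h =>
    Subtype.ext (Sym2.congr_right.1 h)
  rw [← Set.ncard_image_of_injective _ hinj, ← Set.ncard_coe_finset]
  congr 1
  ext e
  simp only [Set.mem_image, SimpleGraph.mem_neighborSet, edgeGraph_adj hS, Finset.coe_filter,
    Set.mem_ofPred_eq]
  constructor
  · rintro ⟨v, hv, rfl⟩
    exact ⟨hv, Sym2.mem_mk_left _ _⟩
  · rintro ⟨he, hx⟩
    obtain ⟨v, rfl⟩ := Sym2.mem_iff_exists.1 hx
    exact ⟨⟨v, mem_verts_of_mem_edges (hS he) (Sym2.mem_mk_right _ _)⟩, he, rfl⟩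

open scoped Classical in
/-- The edge sets of the spanning trees of `SG(n)`. -/
noncomputable def treeEdgeSets (n : ℕ) : Finset (Finset (Sym2 (ℕ × ℕ))) :=
  (edges n).powerset.filter fun S => IsForest n S .tree

theorem mem_treeEdgeSets : S ∈ treeEdgeSets n ↔ S ⊆ edges n ∧ IsForest n S .tree := by
  simp [treeEdgeSets]

theorem image_treeEdgeSets (n : ℕ) :
    edgeGraph n '' (treeEdgeSets n : Set (Finset (Sym2 (ℕ × ℕ)))) = spanningTrees n := by
  ext T
  constructor
  · rintro ⟨S, hS, rfl⟩
    obtain ⟨h1, h2⟩ := mem_treeEdgeSets.1 hS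
    exact ⟨edgeGraph_le h1, (edgeGraph_isTree h1).2 h2⟩
  · rintro ⟨h1, h2⟩
    obtain ⟨S, hS, rfl⟩ := exists_edgeGraph_eq h1
    exact ⟨S, mem_treeEdgeSets.2 ⟨hS, (edgeGraph_isTree hS).1 h2⟩, rfl⟩

theorem f_eq_card (n : ℕ) : f n = (treeEdgeSets n).card := by
  rw [f, ← image_treeEdgeSets, Set.InjOn.ncard_image, Set.ncard_coe_finset]
  exact edgeGraph_injOn.mono fun S hS => (mem_treeEdgeSets.1 hS).1

theorem fdeg_eq_card (j n : ℕ) (x : Vertex n) :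
    fdeg j n x = ((treeEdgeSets n).filter fun S => (S.filter fun e => x.1 ∈ e).card = j).card := by
  have h : {T ∈ spanningTrees n | (T.neighborSet x).ncard = j} = edgeGraph n ''
      (((treeEdgeSets n).filter fun S => (S.filter fun e => x.1 ∈ e).card = j :
        Finset (Finset (Sym2 (ℕ × ℕ)))) : Set (Finset (Sym2 (ℕ × ℕ)))) := by
    rw [← image_treeEdgeSets]
    ext T
    constructor
    · rintro ⟨⟨S, hS, rfl⟩, hj⟩
      rw [ncard_neighborSet_edgeGraph (mem_treeEdgeSets.1 hS).1] at hj
      exact ⟨S, Finset.mem_coe.2 (Finset.mem_filter.2 ⟨hS, hj⟩), rfl⟩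
    · rintro ⟨S, hS, rfl⟩
      obtain ⟨hS, hj⟩ := Finset.mem_filter.1 (Finset.mem_coe.1 hS)
      refine ⟨⟨S, hS, rfl⟩, ?_⟩
      rwa [ncard_neighborSet_edgeGraph (mem_treeEdgeSets.1 hS).1]
  rw [fdeg, h, Set.InjOn.ncard_image, Set.ncard_coe_finset]
  exact edgeGraph_injOn.mono fun S hS =>
    (mem_treeEdgeSets.1 (Finset.mem_filter.1 (Finset.mem_coe.1 hS)).1).1

end bridge

/-! ### Degree generating function and normalisation -/

/-- The weight marking the edges at the point `p` by `y`. -/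
noncomputable def pointWeight (y : ℝ) (p : ℕ × ℕ) (e : Sym2 (ℕ × ℕ)) : ℝ := if p ∈ e then y else 1

theorem forestSum_tree (w : Sym2 (ℕ × ℕ) → ℝ) (n : ℕ) :
    forestSum w n .tree = ∑ S ∈ treeEdgeSets n, ∏ e ∈ S, w e := by
  rw [treeEdgeSets, Finset.sum_filter, forestSum]

theorem f_eq_forestSum (n : ℕ) : (f n : ℝ) = forestSum (fun _ => 1) n .tree := by
  simp [forestSum_tree, f_eq_card]

/-- The numbers `f_j(n, x)` are the coefficients of the degree generating function. -/
theorem fdeg_eq_coeff {n : ℕ} {x : Vertex n} {Q : Polynomial ℝ}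
    (h : ∀ y, forestSum (pointWeight y x.1) n .tree = Q.eval y) (j : ℕ) :
    (fdeg j n x : ℝ) = Q.coeff j := by
  -- Two real polynomials that agree at every `y` are equal.
  have hQ : Q = ∑ S ∈ treeEdgeSets n, Polynomial.X ^ (S.filter fun e => x.1 ∈ e).card := by
    refine Polynomial.funext fun y => ?_
    rw [← h, forestSum_tree, Polynomial.eval_finsetSum]
    refine Finset.sum_congr rfl fun S _ => ?_
    simp [pointWeight, Finset.prod_ite]
  rw [hQ, Polynomial.finsetSum_coeff, fdeg_eq_card, Finset.card_filter]
  push_cast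
  refine Finset.sum_congr rfl fun S _ => ?_
  rw [Polynomial.coeff_X_pow]
  simp only [eq_comm]

/-- The ratio of the number of two-component forests of a given type to the number of trees. -/
noncomputable def ratio (n : ℕ) : ℝ := 1 / 3 * (5 / 3) ^ n

/-- The number of spanning trees, given by its recursion. -/
noncomputable def treeCount : ℕ → ℝ
  | 0 => 3
  | n + 1 => 6 * treeCount n ^ 3 * ratio n

theorem ratio_pos (n : ℕ) : 0 < ratio n := by unfold ratio; positivity

theorem ratio_succ (n : ℕ) : ratio (n + 1) = 5 / 3 * ratio n := by
  unfold ratio; ring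

theorem treeCount_pos (n : ℕ) : 0 < treeCount n := by
  induction n with
  | zero => norm_num [treeCount]
  | succ n ih =>
    have := ratio_pos n
    unfold treeCount
    positivity

/-- The order of magnitude of the number of forests of type `π`. -/
noncomputable def scale (n : ℕ) (π : CornerPart) : ℝ := treeCount n * ratio n ^ (π.blocks - 1)

theorem scale_pos (n : ℕ) (π : CornerPart) : 0 < scale n π :=
  mul_pos (treeCount_pos n) (pow_pos (ratio_pos n) _)

/-- The weighted numbers of spanning forests, divided by their order of magnitude. -/
noncomputable def forestVec (w : Sym2 (ℕ × ℕ) → ℝ) (n : ℕ) (π : CornerPart) : ℝ :=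
  forestSum w n π / scale n π

theorem forestSum_eq (w : Sym2 (ℕ × ℕ) → ℝ) (n : ℕ) (π : CornerPart) :
    forestSum w n π = scale n π * forestVec w n π := by
  rw [forestVec, mul_div_cancel₀ _ (scale_pos n π).ne']

theorem forestVec_congr {w w' : Sym2 (ℕ × ℕ) → ℝ} {n : ℕ} (h : ∀ e ∈ edges n, w e = w' e) :
    forestVec w n = forestVec w' n := by
  funext π
  rw [forestVec, forestVec, forestSum_congr h]

/-- The normalised form of the gluing recursion. -/
noncomputable def glueVec (u v w : CornerPart → ℝ) (π : CornerPart) : ℝ :=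
  (∑ t ∈ admissible π, u t.1 * v t.2.1 * w t.2.2) / (6 * (5 / 3) ^ (π.blocks - 1))

theorem CornerPart.one_le_blocks (π : CornerPart) : 1 ≤ π.blocks := by
  cases π <;> simp [CornerPart.blocks]

/-- In an admissible triple the excesses of the block numbers over 1 sum to `π.blocks`, so the
product of the three scales is the same for all triples and cancels, leaving only the constant in
`glueVec`. -/
theorem forestVec_succ (w : Sym2 (ℕ × ℕ) → ℝ) (n : ℕ) :
    forestVec w (n + 1) = glueVec (forestVec (fun e => w (e.map (shift n 0))) n)
      (forestVec (fun e => w (e.map (shift n 1))) n)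
      (forestVec (fun e => w (e.map (shift n 2))) n) := by
  funext π
  have hscale : ∀ t ∈ admissible π, scale n t.1 * scale n t.2.1 * scale n t.2.2 =
      treeCount n ^ 3 * ratio n ^ π.blocks := by
    intro t ht
    have hb := (Finset.mem_filter.1 ht).2.2
    have h0 := t.1.one_le_blocks
    have h1 := t.2.1.one_le_blocks
    have h2 := t.2.2.one_le_blocks
    have h3 : π.blocks = (t.1.blocks - 1) + (t.2.1.blocks - 1) + (t.2.2.blocks - 1) := by omega
    rw [h3, scale, scale, scale]
    ring
  have hsucc : scale (n + 1) π =
      treeCount n ^ 3 * ratio n ^ π.blocks * (6 * (5 / 3) ^ (π.blocks - 1)) := by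
    obtain ⟨k, hk⟩ := Nat.exists_eq_add_of_le π.one_le_blocks
    rw [scale, hk, ratio_succ, treeCount, Nat.add_sub_cancel_left]
    ring
  have hpos : treeCount n ^ 3 * ratio n ^ π.blocks ≠ 0 :=
    (mul_pos (pow_pos (treeCount_pos n) 3) (pow_pos (ratio_pos n) _)).ne'
  rw [forestVec, glueVec, forestSum_succ, hsucc]
  refine Eq.trans ?_ (mul_div_mul_left _ _ hpos)
  rw [Finset.mul_sum]
  congr 1
  refine Finset.sum_congr rfl fun t ht => ?_
  rw [← hscale t ht]
  simp only [forestSum_eq _ n]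
  ring

section glueVec

open CornerPart

variable (u v w : CornerPart → ℝ)

theorem glueVec_tree : glueVec u v w tree =
    (u tree * v tree * w (iso 0) + u tree * v tree * w (iso 1) + u tree * v (iso 0) * w tree +
      u tree * v (iso 2) * w tree + u (iso 1) * v tree * w tree + u (iso 2) * v tree * w tree)
      / 6 := by
  rw [glueVec, sum_admissible_tree]
  norm_num [blocks]

theorem glueVec_iso_zero : glueVec u v w (iso 0) =
    (u tree * v (iso 0) * w (iso 0) + u (iso 0) * v tree * w (iso 0) + u (iso 0) * v tree * w
      (iso 1) + u (iso 0) * v (iso 0) * w tree + u (iso 0) * v (iso 2) * w tree + u (iso 1) *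
      v tree * w (iso 0) + u (iso 2) * v (iso 0) * w tree + u discrete * v tree * w tree) / 10 := by
  rw [glueVec, sum_admissible_iso_zero]
  norm_num [blocks]

theorem glueVec_iso_one : glueVec u v w (iso 1) =
    (u tree * v (iso 0) * w (iso 1) + u tree * v (iso 1) * w (iso 0) + u tree * v (iso 1) * w
      (iso 1) + u tree * v discrete * w tree + u (iso 1) * v tree * w (iso 1) + u (iso 1) * v
      (iso 1) * w tree + u (iso 1) * v (iso 2) * w tree + u (iso 2) * v (iso 1) * w tree) / 10 := by
  rw [glueVec, sum_admissible_iso_one]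
  norm_num [blocks]

theorem glueVec_iso_two : glueVec u v w (iso 2) =
    (u tree * v tree * w discrete + u tree * v (iso 0) * w (iso 2) + u tree * v (iso 2) * w
      (iso 0) + u tree * v (iso 2) * w (iso 2) + u (iso 1) * v tree * w (iso 2) + u (iso 2) *
      v tree * w (iso 1) + u (iso 2) * v tree * w (iso 2) + u (iso 2) * v (iso 2) * w tree) /
      10 := by
  rw [glueVec, sum_admissible_iso_two]
  norm_num [blocks]

theorem glueVec_discrete : glueVec u v w discrete =
    (u tree * v (iso 0) * w discrete + u tree * v (iso 1) * w discrete + u tree * v discrete *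
      w (iso 0) + u tree * v discrete * w (iso 2) + u (iso 0) * v tree * w discrete + u (iso
      0) * v (iso 0) * w (iso 1) + u (iso 0) * v (iso 0) * w (iso 2) + u (iso 0) * v (iso 1) *
      w (iso 0) + u (iso 0) * v (iso 1) * w (iso 1) + u (iso 0) * v (iso 2) * w (iso 0) + u
      (iso 0) * v (iso 2) * w (iso 2) + u (iso 0) * v discrete * w tree + u (iso 1) * v tree *
      w discrete + u (iso 1) * v (iso 1) * w (iso 0) + u (iso 1) * v (iso 1) * w (iso 2) + u
      (iso 1) * v (iso 2) * w (iso 0) + u (iso 1) * v (iso 2) * w (iso 2) + u (iso 2) * v (iso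
      0) * w (iso 1) + u (iso 2) * v (iso 0) * w (iso 2) + u (iso 2) * v (iso 1) * w (iso 1) +
      u (iso 2) * v (iso 1) * w (iso 2) + u (iso 2) * v discrete * w tree + u discrete * v
      tree * w (iso 1) + u discrete * v tree * w (iso 2) + u discrete * v (iso 1) * w tree + u
      discrete * v (iso 2) * w tree) / (50 / 3) := by
  rw [glueVec, sum_admissible_discrete]
  norm_num [blocks]

end glueVec

theorem CornerPart.funext_iff {u v : CornerPart → ℝ} : u = v ↔ u .tree = v .tree ∧
    u (.iso 0) = v (.iso 0) ∧ u (.iso 1) = v (.iso 1) ∧ u (.iso 2) = v (.iso 2) ∧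
    u .discrete = v .discrete := by
  refine ⟨fun h => by simp [h], fun ⟨h1, h2, h3, h4, h5⟩ => funext fun π => ?_⟩
  rcases π with _ | i | _
  · exact h1
  · fin_cases i
    exacts [h2, h3, h4]
  · exact h5

/-- The normalised vector of the unweighted numbers of forests. -/
def plainVec : CornerPart → ℝ
  | .discrete => 3
  | _ => 1

theorem forestVec_zero (w : Sym2 (ℕ × ℕ) → ℝ) :
    forestVec w 0 .tree = (w (side 0 1) * w (side 0 2) + w (side 0 1) * w (side 1 2) +
      w (side 0 2) * w (side 1 2)) / 3 ∧
    forestVec w 0 (.iso 0) = w (side 1 2) ∧ forestVec w 0 (.iso 1) = w (side 0 2) ∧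
    forestVec w 0 (.iso 2) = w (side 0 1) ∧ forestVec w 0 .discrete = 3 := by
  simp only [forestVec, forestSum_zero_tree, forestSum_zero_iso_zero, forestSum_zero_iso_one,
    forestSum_zero_iso_two, forestSum_zero_discrete, scale, treeCount, ratio, CornerPart.blocks]
  norm_num

/-- With all edge weights equal to 1 the gluing sums are 6, 10 and 50; the first two dictate the
recursions of `treeCount` and `ratio`, and `plainVec` is then a fixed point. -/
theorem forestVec_one (n : ℕ) : forestVec (fun _ => 1) n = plainVec := by
  induction n with
  | zero =>
    obtain ⟨h1, h2, h3, h4, h5⟩ := forestVec_zero fun _ => 1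
    rw [CornerPart.funext_iff, h1, h2, h3, h4, h5]
    norm_num [plainVec]
  | succ n ih =>
    rw [forestVec_succ, ih, CornerPart.funext_iff, glueVec_tree, glueVec_iso_zero, glueVec_iso_one,
      glueVec_iso_two, glueVec_discrete]
    norm_num [plainVec]

/-! ### Linear recursions for a marked point -/

section pointWeight

variable {n : ℕ} (y : ℝ)

theorem pointWeight_shift (i : Fin 3) (u : ℕ × ℕ) :
    (fun e : Sym2 (ℕ × ℕ) => pointWeight y (shift n i u) (e.map (shift n i))) =
      pointWeight y u := by
  funext e
  have : shift n i u ∈ e.map (shift n i) ↔ u ∈ e := by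
    rw [Sym2.mem_map]
    exact ⟨fun ⟨v, hv, h⟩ => shift_injective n i h ▸ hv, fun h => ⟨u, h, rfl⟩⟩
  simp only [pointWeight, this]

theorem forestVec_pointWeight_of_notMem {i : Fin 3} {p : ℕ × ℕ}
    (hp : ∀ u ∈ verts n, shift n i u ≠ p) :
    forestVec (fun e => pointWeight y p (e.map (shift n i))) n = plainVec := by
  rw [← forestVec_one n]
  refine forestVec_congr fun e he => if_neg fun h => ?_
  obtain ⟨u, hu, hup⟩ := Sym2.mem_map.1 h
  exact hp u (mem_verts_of_mem_edges he hu) hup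

/-- Constant part of the normalised number of trees with a marked corner. -/
noncomputable def limitPart : ℝ := (y ^ 2 + 2 * y) / 3 - 5 / 42 * (y ^ 2 - y)

/-- Coefficient of `(1 / 15) ^ n` in the normalised number of trees with a marked corner. -/
noncomputable def decayPart : ℝ := 5 / 42 * (y ^ 2 - y)

/-- Coefficient of `(3 / 5) ^ n` in the normalised number of forests isolating a marked corner. -/
noncomputable def slowPart : ℝ :=
  (33 - 33 * limitPart y - 81 / 5 * decayPart y) / 28

/-- Coefficient of `(1 / 25) ^ n` in the normalised number of forests isolating a marked corner. -/
noncomputable def fastPart : ℝ :=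
  1 - limitPart y - 12 / 5 * decayPart y - slowPart y

/-- The normalised vector of `SG(n)` with marked corner `c`. -/
noncomputable def cornerVec (n : ℕ) (c : Fin 3) : CornerPart → ℝ
  | .tree => limitPart y + decayPart y * (1 / 15) ^ n
  | .iso i => if i = c then limitPart y + 12 / 5 * decayPart y * (1 / 15) ^ n +
      slowPart y * (3 / 5) ^ n + fastPart y * (1 / 25) ^ n
    else limitPart y - 9 / 5 * decayPart y * (1 / 15) ^ n
  | .discrete => 3 * limitPart y - 27 / 5 * decayPart y * (1 / 15) ^ n +
      2 * slowPart y * (3 / 5) ^ n - 18 / 5 * fastPart y * (1 / 25) ^ n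

/-- Exactly one copy sees the mark. The tree entry and the two equal entries isolating an unmarked
corner form a closed system with eigenvalues 1 and 1/15. Modulo these, the entry isolating the
marked corner and the discrete entry have eigenvalues 3/5 and 1/25, with eigenvectors (1, 2) and (1,
-18/5). The coefficients are fitted to the triangle, where the entries are `(y ^ 2 + 2 * y) / 3`,
`y`, 1 and 3. -/
theorem forestVec_corner (n : ℕ) (c : Fin 3) :
    forestVec (pointWeight y (corner n c)) n = cornerVec y n c := by
  induction n with
  | zero =>
    obtain ⟨h1, h2, h3, h4, h5⟩ := forestVec_zero (pointWeight y (corner 0 c))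
    rw [CornerPart.funext_iff, h1, h2, h3, h4, h5]
    fin_cases c <;>
    · simp only [pointWeight, Sym2.mem_iff, (corner_injective 0).eq_iff]
      refine ⟨?_, ?_, ?_, ?_, ?_⟩ <;>
        simp [cornerVec, limitPart, decayPart, slowPart, fastPart] <;> ring
  | succ n ih =>
    have hmark : forestVec (fun e => pointWeight y (corner (n + 1) c) (e.map (shift n c))) n =
        cornerVec y n c := by
      rw [← shift_corner_self, pointWeight_shift, ih]
    have hplain : ∀ i, i ≠ c →
        forestVec (fun e => pointWeight y (corner (n + 1) c) (e.map (shift n i))) n = plainVec := by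
      intro i hi
      refine forestVec_pointWeight_of_notMem y fun u hu h => hi ?_
      rw [← shift_corner_self] at h
      exact (corner_injective n (eq_corner_of_shift_eq hi hu (corner_mem_verts n c) h).2).symm
    rw [forestVec_succ, CornerPart.funext_iff, glueVec_tree, glueVec_iso_zero, glueVec_iso_one,
      glueVec_iso_two, glueVec_discrete]
    fin_cases c
    · simp only [Fin.zero_eta] at hmark hplain ⊢
      rw [hmark, hplain 1 (by decide), hplain 2 (by decide)]
      simp only [cornerVec, plainVec, pow_succ]
      simp
      refine ⟨?_, ?_, ?_, ?_, ?_⟩ <;> ring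
    · simp only [Fin.mk_one] at hmark hplain ⊢
      rw [hmark, hplain 0 (by decide), hplain 2 (by decide)]
      simp only [cornerVec, plainVec, pow_succ]
      simp
      refine ⟨?_, ?_, ?_, ?_, ?_⟩ <;> ring
    · simp only [Fin.reduceFinMk] at hmark hplain ⊢
      rw [hmark, hplain 0 (by decide), hplain 1 (by decide)]
      simp only [cornerVec, plainVec, pow_succ]
      simp
      refine ⟨?_, ?_, ?_, ?_, ?_⟩ <;> ring

/-- The corner common to the copies `i` and `j` is a marked corner of both. -/
theorem forestVec_junction_copy (n : ℕ) (i j : Fin 3) :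
    forestVec (fun e => pointWeight y (shift n i (corner n j)) (e.map (shift n i))) n =
      cornerVec y n j := by
  rw [pointWeight_shift, forestVec_corner]

theorem forestVec_junction_other (n : ℕ) {i j k : Fin 3} (hi : k ≠ i) (hj : k ≠ j) :
    forestVec (fun e => pointWeight y (shift n i (corner n j)) (e.map (shift n k))) n =
      plainVec := by
  refine forestVec_pointWeight_of_notMem y fun u hu h => hj ?_
  exact (corner_injective n (eq_corner_of_shift_eq hi hu (corner_mem_verts n j) h).2).symm

/-- Passing to larger stages, with the marked point staying in the left copy. -/
theorem forestVec_add (n m : ℕ) {p : ℕ × ℕ}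
    (hp : ∀ k i, i ≠ 0 → ∀ u ∈ verts (n + k), shift (n + k) i u ≠ p) :
    let v := forestVec (pointWeight y p) n
    forestVec (pointWeight y p) (n + m) .tree =
        (9 * v .tree + 5 * ((v (.iso 1) + v (.iso 2)) / 2)) / 14 +
        5 / 14 * (v .tree - (v (.iso 1) + v (.iso 2)) / 2) * (1 / 15) ^ m ∧
      (forestVec (pointWeight y p) (n + m) (.iso 1) +
        forestVec (pointWeight y p) (n + m) (.iso 2)) / 2 =
        (9 * v .tree + 5 * ((v (.iso 1) + v (.iso 2)) / 2)) / 14 -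
        9 / 14 * (v .tree - (v (.iso 1) + v (.iso 2)) / 2) * (1 / 15) ^ m := by
  intro v
  induction m with
  | zero => constructor <;> simp only [add_zero, pow_zero, v] <;> ring
  | succ m ih =>
    have h0 : forestVec (fun e => pointWeight y p (e.map (shift (n + m) 0))) (n + m) =
        forestVec (pointWeight y p) (n + m) := by
      have := pointWeight_shift (n := n + m) y 0 p
      rw [shift_zero] at this
      rw [this]
    have h1 := forestVec_pointWeight_of_notMem y (hp m 1 (by decide))
    have h2 := forestVec_pointWeight_of_notMem y (hp m 2 (by decide))
    rw [← add_assoc, forestVec_succ, h0, h1, h2, glueVec_tree, glueVec_iso_one, glueVec_iso_two]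
    obtain ⟨ih1, ih2⟩ := ih
    simp only [plainVec, pow_succ]
    -- For the tree entry `t` and the mean `s` of the other two, the recursion has rows (2/3, 1/3)
    -- and (3/5, 2/5). It preserves `(9 t + 5 s) / 14` and multiplies `t - s` by 1/15.
    constructor
    · linear_combination (2 / 3) * ih1 + (1 / 3) * ih2
    · linear_combination (3 / 5) * ih1 + (2 / 5) * ih2

end pointWeight

/-! ### Marked junctions and extraction of coefficients -/

theorem shift_ne_of_lt {n k : ℕ} {p : ℕ × ℕ} (h1 : p.1 < 2 ^ n) (h2 : p.2 < 2 ^ n) {i : Fin 3}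
    (hi : i ≠ 0) (u : ℕ × ℕ) : shift (n + k) i u ≠ p := by
  have hk : 2 ^ n ≤ 2 ^ (n + k) := Nat.pow_le_pow_right (by norm_num) (Nat.le_add_right n k)
  rintro rfl
  fin_cases i
  · exact hi rfl
  · simp [shift, corner_one] at h1
    omega
  · simp [shift, corner_two] at h2
    omega

theorem f_eq_treeCount (n : ℕ) : (f n : ℝ) = treeCount n := by
  rw [f_eq_forestSum, forestSum_eq, forestVec_one]
  simp [scale, plainVec, CornerPart.blocks]

/-- On trees the scale is `treeCount n`, which equals `f n`; the normalised tree entry is thus the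
probability generating function of the degree. -/
theorem F_eq_of_forestVec {n : ℕ} {x : Vertex n} {c₁ c₂ c₃ c₄ : ℝ}
    (h : ∀ y, forestVec (pointWeight y x.1) n .tree =
      c₁ * y + c₂ * y ^ 2 + c₃ * y ^ 3 + c₄ * y ^ 4) :
    F 1 n x = c₁ ∧ F 2 n x = c₂ ∧ F 3 n x = c₃ ∧ F 4 n x = c₄ := by
  have hQ := fdeg_eq_coeff (x := x) (Q := Polynomial.C (treeCount n) *
    (Polynomial.C c₁ * Polynomial.X + Polynomial.C c₂ * Polynomial.X ^ 2 +
      Polynomial.C c₃ * Polynomial.X ^ 3 + Polynomial.C c₄ * Polynomial.X ^ 4)) fun y => by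
    rw [forestSum_eq, h]
    simp [scale, CornerPart.blocks]
  have hpos := (treeCount_pos n).ne'
  refine ⟨?_, ?_, ?_, ?_⟩ <;>
  · rw [F, hQ, f_eq_treeCount, Polynomial.coeff_C_mul, mul_div_cancel_left₀ _ hpos]
    simp [Polynomial.coeff_X_pow]

/-- One gluing creates the junction in stage `n + 1`. From then on it stays in the left copy, off
the other two, so the linear recursion applies `m` times. -/
theorem forestVec_junction {n : ℕ} (m : ℕ) (y : ℝ) {i j : Fin 3} {u v w : CornerPart → ℝ}
    (hij : i ≠ j)
    (hu : forestVec (fun e => pointWeight y (shift n i (corner n j)) (e.map (shift n 0))) n = u)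
    (hv : forestVec (fun e => pointWeight y (shift n i (corner n j)) (e.map (shift n 1))) n = v)
    (hw : forestVec (fun e => pointWeight y (shift n i (corner n j)) (e.map (shift n 2))) n = w) :
    forestVec (pointWeight y (shift n i (corner n j))) (n + m + 1) .tree =
      (9 * glueVec u v w .tree +
        5 * ((glueVec u v w (.iso 1) + glueVec u v w (.iso 2)) / 2)) / 14 +
      5 / 14 * (glueVec u v w .tree -
        (glueVec u v w (.iso 1) + glueVec u v w (.iso 2)) / 2) * (1 / 15) ^ m := by
  have hlt : (shift n i (corner n j)).1 < 2 ^ (n + 1) ∧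
      (shift n i (corner n j)).2 < 2 ^ (n + 1) := by
    have h0 : 0 < 2 ^ n := by positivity
    rw [pow_succ]
    fin_cases i <;> fin_cases j <;>
      simp [shift, corner_zero, corner_one, corner_two] at hij ⊢
  have h := (forestVec_add y (n + 1) m (p := shift n i (corner n j)) fun k i hi u _ =>
    shift_ne_of_lt hlt.1 hlt.2 hi u).1
  rw [forestVec_succ, hu, hv, hw] at h
  rw [add_right_comm]
  exact h

/-- All powers become monomials in `(3 / 5) ^ n` and `(1 / 15) ^ n`, so that `ring` can compare the
two sides. -/
theorem pow_relations (n : ℕ) :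
    (1 / 25 : ℝ) ^ n = (3 / 5) ^ n * (1 / 15) ^ n ∧
    (1 / 375 : ℝ) ^ n = (3 / 5) ^ n * ((1 / 15) ^ n) ^ 2 ∧
    (1 / 225 : ℝ) ^ n = ((1 / 15) ^ n) ^ 2 := by
  refine ⟨?_, ?_, ?_⟩
  · rw [← mul_pow]; norm_num
  · rw [← pow_mul, mul_comm n 2, pow_mul, ← mul_pow]; norm_num
  · rw [← pow_mul, mul_comm n 2, pow_mul]; norm_num

theorem forestVec_a (n m : ℕ) (y : ℝ) :
    forestVec (pointWeight y (a n m).1) (n + m + 1) .tree =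
      (9 * glueVec (cornerVec y n 1) (cornerVec y n 0) plainVec .tree +
        5 * ((glueVec (cornerVec y n 1) (cornerVec y n 0) plainVec (.iso 1) +
          glueVec (cornerVec y n 1) (cornerVec y n 0) plainVec (.iso 2)) / 2)) / 14 +
      5 / 14 * (glueVec (cornerVec y n 1) (cornerVec y n 0) plainVec .tree -
        (glueVec (cornerVec y n 1) (cornerVec y n 0) plainVec (.iso 1) +
          glueVec (cornerVec y n 1) (cornerVec y n 0) plainVec (.iso 2)) / 2) * (1 / 15) ^ m := by
  have hp : (a n m).1 = shift n 0 (corner n 1) := by rw [shift_zero, corner_one, a]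
  rw [hp]
  -- The point is corner 1 of the left copy and corner 0 of the right copy; the top copy does not
  -- contain it.
  refine forestVec_junction m y (by decide) (forestVec_junction_copy y n 0 1) ?_
    (forestVec_junction_other y n (by decide) (by decide))
  rw [shift_corner_comm]
  exact forestVec_junction_copy y n 1 0

theorem forestVec_c (n m : ℕ) (y : ℝ) :
    forestVec (pointWeight y (c n m).1) (n + m + 1) .tree =
      (9 * glueVec plainVec (cornerVec y n 2) (cornerVec y n 1) .tree +
        5 * ((glueVec plainVec (cornerVec y n 2) (cornerVec y n 1) (.iso 1) +
          glueVec plainVec (cornerVec y n 2) (cornerVec y n 1) (.iso 2)) / 2)) / 14 +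
      5 / 14 * (glueVec plainVec (cornerVec y n 2) (cornerVec y n 1) .tree -
        (glueVec plainVec (cornerVec y n 2) (cornerVec y n 1) (.iso 1) +
          glueVec plainVec (cornerVec y n 2) (cornerVec y n 1) (.iso 2)) / 2) * (1 / 15) ^ m := by
  have hp : (c n m).1 = shift n 1 (corner n 2) := by
    rw [shift, corner_one, corner_two, c]
    simp
  rw [hp]
  -- The point is corner 2 of the right copy and corner 1 of the top copy; the left copy does not
  -- contain it.
  refine forestVec_junction m y (by decide)
    (forestVec_junction_other y n (by decide) (by decide)) (forestVec_junction_copy y n 1 2) ?_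
  rw [shift_corner_comm]
  exact forestVec_junction_copy y n 2 1

end SierpinskiGasket

open SierpinskiGasket in
theorem mainTheorem3 (n m : ℕ) :
    F 1 (n + m + 1) (a n m) =
        1815 / 5488 * (3 / 5) ^ n - 99 / 1372 * (1 / 25) ^ n + 55 / 16464 * (1 / 375) ^ n
        + (1 / 15) ^ m *
          (-121 / 5488 * (3 / 5) ^ n - 22 / 1029 * (1 / 25) ^ n + 185 / 49392 * (1 / 375) ^ n) ∧
    F 2 (n + m + 1) (a n m) =
        121 / 196 - 825 / 5488 * (3 / 5) ^ n + 171 / 1372 * (1 / 25) ^ n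
        - 55 / 5488 * (1 / 375) ^ n - 121 / 1176 * (1 / 15) ^ n + 1 / 294 * (1 / 225) ^ n
        + (1 / 15) ^ m *
          (55 / 5488 * (3 / 5) ^ n + 38 / 1029 * (1 / 25) ^ n
            - 185 / 16464 * (1 / 375) ^ n - 143 / 3528 * (1 / 15) ^ n + 11 / 2646 * (1 / 225) ^ n) ∧
    F 3 (n + m + 1) (a n m) =
        33 / 98 - 855 / 5488 * (3 / 5) ^ n - 45 / 1372 * (1 / 25) ^ n
        + 55 / 5488 * (1 / 375) ^ n + 11 / 147 * (1 / 15) ^ n - 1 / 147 * (1 / 225) ^ n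
        + (1 / 15) ^ m *
          (57 / 5488 * (3 / 5) ^ n - 10 / 1029 * (1 / 25) ^ n
            + 185 / 16464 * (1 / 375) ^ n + 13 / 441 * (1 / 15) ^ n - 11 / 1323 * (1 / 225) ^ n) ∧
    F 4 (n + m + 1) (a n m) =
        9 / 196 - 135 / 5488 * (3 / 5) ^ n - 27 / 1372 * (1 / 25) ^ n
        - 55 / 16464 * (1 / 375) ^ n + 11 / 392 * (1 / 15) ^ n + 1 / 294 * (1 / 225) ^ n
        + (1 / 15) ^ m *
          (9 / 5488 * (3 / 5) ^ n - 2 / 343 * (1 / 25) ^ n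
            - 185 / 49392 * (1 / 375) ^ n + 13 / 1176 * (1 / 15) ^ n + 11 / 2646 * (1 / 225) ^ n) ∧
    F 1 (n + m + 1) (c n m) =
        1089 / 2744 * (3 / 5) ^ n - 22 / 343 * (1 / 25) ^ n + 5 / 8232 * (1 / 375) ^ n
        + (1 / 15) ^ m *
          (-121 / 1372 * (3 / 5) ^ n - 121 / 4116 * (1 / 25) ^ n + 20 / 3087 * (1 / 375) ^ n) ∧
    F 2 (n + m + 1) (c n m) =
        121 / 196 - 495 / 2744 * (3 / 5) ^ n + 38 / 343 * (1 / 25) ^ n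
        - 5 / 2744 * (1 / 375) ^ n - 55 / 588 * (1 / 15) ^ n
        + (1 / 15) ^ m *
          (55 / 1372 * (3 / 5) ^ n + 209 / 4116 * (1 / 25) ^ n
            - 20 / 1029 * (1 / 375) ^ n - 22 / 441 * (1 / 15) ^ n + 10 / 1323 * (1 / 225) ^ n) ∧
    F 3 (n + m + 1) (c n m) =
        33 / 98 - 513 / 2744 * (3 / 5) ^ n - 10 / 343 * (1 / 25) ^ n
        + 5 / 2744 * (1 / 375) ^ n + 10 / 147 * (1 / 15) ^ n
        + (1 / 15) ^ m *
          (57 / 1372 * (3 / 5) ^ n - 55 / 4116 * (1 / 25) ^ n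
            + 20 / 1029 * (1 / 375) ^ n + 16 / 441 * (1 / 15) ^ n - 20 / 1323 * (1 / 225) ^ n) ∧
    F 4 (n + m + 1) (c n m) =
        9 / 196 - 81 / 2744 * (3 / 5) ^ n - 6 / 343 * (1 / 25) ^ n
        - 5 / 8232 * (1 / 375) ^ n + 5 / 196 * (1 / 15) ^ n
        + (1 / 15) ^ m *
          (9 / 1372 * (3 / 5) ^ n - 11 / 1372 * (1 / 25) ^ n
            - 20 / 3087 * (1 / 375) ^ n + 2 / 147 * (1 / 15) ^ n + 10 / 1323 * (1 / 225) ^ n) := by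
  have assemble : ∀ {p₁ p₂ p₃ p₄ q : Prop}, (p₁ ∧ p₂ ∧ p₃ ∧ p₄) → q → p₁ ∧ p₂ ∧ p₃ ∧ p₄ ∧ q :=
    fun ⟨h₁, h₂, h₃, h₄⟩ h => ⟨h₁, h₂, h₃, h₄, h⟩
  obtain ⟨h25, h375, h225⟩ := pow_relations n
  rw [h25, h375, h225]
  refine assemble (F_eq_of_forestVec fun y => ?_) (F_eq_of_forestVec fun y => ?_)
  -- No `(9 / 25) ^ n` arises: if both copies isolated the junction, it would be cut off from every
  -- outer corner, so such triples are not admissible.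
  · rw [forestVec_a, glueVec_tree, glueVec_iso_one, glueVec_iso_two]
    simp only [cornerVec, plainVec, h25]
    simp only [Fin.reduceEq, if_true, if_false, slowPart, fastPart, limitPart, decayPart]
    ring
  · rw [forestVec_c, glueVec_tree, glueVec_iso_one, glueVec_iso_two]
    simp only [cornerVec, plainVec, h25]
    simp only [Fin.reduceEq, if_true, if_false, slowPart, fastPart, limitPart, decayPart]
    ring
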